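/- **Definitions.** Let $(M,g)$ be a smooth Riemannian manifold of dimension $m\ge 1$ with (possibly empty) boundary $\partial M$, and give $\partial M$ the induced metric. Let $R$ be the curvature tensor of $M$, $\nabla$ the Levi-Civita connection of $M$, $\bar\nabla$ that of $\partial M$, $\nu$ the inward unit normal field of $\partial M$, and $l(X,Y)=g(\nabla_XY,\nu)$ the second fundamental form of $\partial M$. For $s\ge 0$ put $N(s)=\{\exp_{p}(t\nu_{p}) : p\in\partial M,\ 0\le t\le s\}$. One says that $M$ has *(coordinate-free defined) bounded geometry* if - (N) there is $r_C>0$ such that the geodesic collar $\partial M\times[0,r_C)\to M$, $(p,t)\mapsto\exp_p(t\nu_p)$, is defined and a diffeomorphism onto its image; - (IC) the injectivity radius of $\partial M$ is positive; - (I) there is $r_i>0$ such that for all $0<r\le r_i$ and all $x\in M\setminus N(r)$ the exponential map $\exp_x$ is defined on the ball $B(0,r)\subset T_xM$ and is a diffeomorphism of this ball onto its image; - (B) for every $k\in\mathbb N$ there is $C_k>0$ such that $|\nabla^iR|\le C_k$ on $M$ and $|\bar\nabla^i l|\le C_k$ on $\partial M$ for $0\le i\le k$. For a manifold without boundary, (N)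 and (IC) and the condition on $l$ are void and $N(r)=\emptyset$: bounded geometry then means that there is $r_i>0$ such that $\exp_x$ is a diffeomorphism of $B(0,r)$ onto its image for all points $x$ and all $0<r\le r_i$, and that each $|\nabla^iR|$ is bounded. **Corollary.** If $(M,g)$ has (coordinate-free defined) bounded geometry, then so has its boundary $\partial M$, a manifold without boundary, with the induced Riemannian metric. -/

import Mathlib

open Set Function Manifold
open scoped Manifold ContDiff ENNReal NNReal

noncomputable section
namespace BddGeom

/-! ### Riemannian calculus in a coordinate domain

`S` is a subset of a vector space `E` (all of `E`, or a closed half-space) and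
`G y` is the metric tensor at the point `y`, a bilinear form on `E`. All derivatives are taken
within `S`, so that they make sense at the boundary of a half-space. Covariant `k`-tensors are given
by their values on `k`-tuples of vectors. -/

section Coordinates

variable {E : Type*} [NormedAddCommGroup E] [NormedSpace ℝ E]

/-- The Christoffel symbols `Γ_y(u, v) = ∇_u v` (for constant vector fields `u`, `v`) of the
Levi-Civita connection of `G`, determined by
`2 G(Γ(u, v), w) = (D_u G)(v, w) + (D_v G)(u, w) - (D_w G)(u, v)`. -/
def christoffel (S : Set E) (G : E → E →L[ℝ] E →L[ℝ] ℝ) (y u v : E) : E :=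
  (G y).inverse ((1 / 2 : ℝ) • (fderivWithin ℝ G S y u v + fderivWithin ℝ G S y v u -
    ((fderivWithin ℝ G S y).flip u).flip v))

/-- The curvature `R(u, v) w = ∇_u ∇_v w - ∇_v ∇_u w` (for constant vector fields). -/
def curvature (S : Set E) (G : E → E →L[ℝ] E →L[ℝ] ℝ) (y u v w : E) : E :=
  fderivWithin ℝ (fun z => christoffel S G z v w) S y u
    - fderivWithin ℝ (fun z => christoffel S G z u w) S y v
    + christoffel S G y u (christoffel S G y v w) - christoffel S G y v (christoffel S G y u w)

/-- The curvature as a covariant `4`-tensor, `(u, v, w, z) ↦ G(R(u, v) w, z)`. -/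
def curvatureTensor (S : Set E) (G : E → E →L[ℝ] E →L[ℝ] ℝ) (y : E) (v : Fin 4 → E) : ℝ :=
  G y (curvature S G y (v 0) (v 1) (v 2)) (v 3)

/-- The covariant derivative of a covariant `k`-tensor field; the new slot is the last one:
`(∇T)(v₁, …, v_k, X) = X.T(v₁, …, v_k) - ∑ i, T(v₁, …, ∇_X v_i, …, v_k)`. -/
def covDeriv (S : Set E) (G : E → E →L[ℝ] E →L[ℝ] ℝ) {k : ℕ} (T : E → (Fin k → E) → ℝ)
    (y : E) (v : Fin (k + 1) → E) : ℝ :=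
  fderivWithin ℝ (fun z => T z (Fin.init v)) S y (v (Fin.last k))
    - ∑ i, T y (update (Fin.init v) i (christoffel S G y (v (Fin.last k)) (Fin.init v i)))

/-- The iterated covariant derivative `∇^i T`. -/
def iterCovDeriv (S : Set E) (G : E → E →L[ℝ] E →L[ℝ] ℝ) {k : ℕ} (T : E → (Fin k → E) → ℝ) :
    (i : ℕ) → E → (Fin (k + i) → E) → ℝ
  | 0 => T
  | i + 1 => covDeriv S G (iterCovDeriv S G T i)

/-- The norm of a covariant `k`-tensor with respect to an inner product `B`: the supremum of its
values on `k`-tuples of vectors of length at most `1`. (In a fixed dimension the usual tensor norms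
are equivalent, with constants that depend on the dimension and `k` only.) -/
def tensorNorm (B : E →L[ℝ] E →L[ℝ] ℝ) {k : ℕ} (T : (Fin k → E) → ℝ) : ℝ≥0∞ :=
  ⨆ (v : Fin k → E) (_ : ∀ i, B (v i) (v i) ≤ 1), ENNReal.ofReal |T v|

end Coordinates

/-! ### Smooth Riemannian manifolds, possibly with boundary -/

section Manifolds

variable {E : Type*} [NormedAddCommGroup E] [NormedSpace ℝ E]
  {H : Type*} [TopologicalSpace H] (I : ModelWithCorners ℝ E H)
  {M : Type*} [TopologicalSpace M] [ChartedSpace H M] [IsManifold I ∞ M]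
  (g : Bundle.ContMDiffRiemannianMetric I ∞ E (fun x : M => TangentSpace I x))

/-- The metric tensor in the chart at `x`: at the point `y` of the coordinate domain it is
`(v, w) ↦ g (dψ v) (dψ w)`, where `ψ` is the inverse of the chart. -/
def chartMetric (x : M) (y : E) : E →L[ℝ] E →L[ℝ] ℝ :=
  ContinuousLinearMap.bilinearComp (E := E) (F := E) (E' := E) (F' := E)
    (g.inner ((extChartAt I x).symm y))
    (mfderivWithin 𝓘(ℝ, E) I (extChartAt I x).symm (range I) y)
    (mfderivWithin 𝓘(ℝ, E) I (extChartAt I x).symm (range I) y)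

/-- The tensor `∇^i R` at the point `x`, computed in the chart at `x`. -/
def nablaR (i : ℕ) (x : M) : (Fin (4 + i) → TangentSpace I x) → ℝ :=
  iterCovDeriv (range I) (chartMetric I g x) (curvatureTensor (range I) (chartMetric I g x)) i
    (extChartAt I x x)

/-- The pointwise norm `|∇^i R|` at `x`. -/
def normNablaR (i : ℕ) (x : M) : ℝ≥0∞ :=
  tensorNorm (E := E) (g.inner x) (nablaR I g i x)

/-- `γ` is a geodesic on the interval `J`: it is smooth and `γ'' + Γ(γ', γ') = 0`; at the time `t`
the equation is written in the chart at `γ t`. -/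
def IsGeodesicOn (γ : ℝ → M) (J : Set ℝ) : Prop :=
  ContMDiffOn 𝓘(ℝ, ℝ) I ∞ γ J ∧
    ∀ t ∈ J, derivWithin (derivWithin (fun s => extChartAt I (γ t) (γ s)) J) J t +
      christoffel (range I) (chartMetric I g (γ t)) (extChartAt I (γ t) (γ t))
        (derivWithin (fun s => extChartAt I (γ t) (γ s)) J t)
        (derivWithin (fun s => extChartAt I (γ t) (γ s)) J t) = 0

/-- `IsExp I g x v y`: the exponential map of `M` at `x` is defined at `v ∈ T_x M`, and
`exp_x v = y`. That is, a geodesic on `[0, 1]` starts at `x` with velocity `v` and ends at `y`. -/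
def IsExp (x : M) (v : TangentSpace I x) (y : M) : Prop :=
  ∃ γ : ℝ → M, IsGeodesicOn I g γ (Icc 0 1) ∧
    (⟨γ 0, mfderivWithin 𝓘(ℝ, ℝ) I γ (Icc 0 1) 0 (1 : ℝ)⟩ : TangentBundle I M) = ⟨x, v⟩ ∧
    γ 1 = y

/-- The restriction of `f` to `s` is a diffeomorphism onto its image `f '' s`. -/
def IsDiffeoOntoImageOn {E' : Type*} [NormedAddCommGroup E'] [NormedSpace ℝ E']
    {H' : Type*} [TopologicalSpace H'] (I' : ModelWithCorners ℝ E' H')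
    {N : Type*} [TopologicalSpace N] [ChartedSpace H' N] (f : N → M) (s : Set N) : Prop :=
  ContMDiffOn I' I ∞ f s ∧
    (s.Nonempty → ∃ h : M → N, LeftInvOn h f s ∧ ContMDiffOn I I' ∞ h (f '' s))

/-- The ball `B(0, r)` in `T_x M`. -/
def tangentBall (x : M) (r : ℝ) : Set E :=
  {v : E | 0 < r ∧ g.inner x v v < r ^ 2}

/-- The exponential map at `x` is defined on `B(0, r) ⊆ T_x M`, and it maps this ball
diffeomorphically onto its image. -/
def ExpDiffeoOnBall (x : M) (r : ℝ) : Prop :=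
  ∃ f : E → M, (∀ v ∈ tangentBall I g x r, IsExp I g x v (f v)) ∧
    IsDiffeoOntoImageOn I 𝓘(ℝ, E) f (tangentBall I g x r)

/-- The injectivity radius of a Riemannian manifold: the infimum over the points `x` of the supremum
of the radii of the balls in `T_x M` on which the exponential map is a diffeomorphism. -/
def injectivityRadius : ℝ≥0∞ :=
  ⨅ x : M, ⨆ (r : ℝ≥0) (_ : ExpDiffeoOnBall I g x r), (r : ℝ≥0∞)

end Manifolds

/-! ### The boundary of a manifold, as a Riemannian manifold -/

lemma contDiff_bilinearComp {E E' : Type*} [NormedAddCommGroup E] [NormedSpace ℝ E]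
    [NormedAddCommGroup E'] [NormedSpace ℝ E'] :
    ContDiff ℝ ∞ (fun P : (E →L[ℝ] E →L[ℝ] ℝ) × (E' →L[ℝ] E) =>
      ContinuousLinearMap.bilinearComp P.1 P.2 P.2) := by
  let L : (E' →L[ℝ] E) →L[ℝ] (E →L[ℝ] ℝ) →L[ℝ] (E' →L[ℝ] ℝ) :=
    (ContinuousLinearMap.compL ℝ E' E ℝ).flip
  have h1 : ContDiff ℝ ∞ (fun P : (E →L[ℝ] E →L[ℝ] ℝ) × (E' →L[ℝ] E) => L P.2) := by
    have h0 : ContDiff ℝ ∞ (fun A => L A) := by fun_prop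
    exact h0.comp contDiff_snd
  exact h1.clm_comp (contDiff_fst.clm_comp contDiff_snd)

section Boundary
variable {n : ℕ}

/-- `y ↦ (0, y)`. -/
def bdIncl (n : ℕ) : EuclideanSpace ℝ (Fin n) →L[ℝ] EuclideanSpace ℝ (Fin (n + 1)) :=
  LinearMap.toContinuousLinearMap
    { toFun := fun y => WithLp.toLp 2 (Fin.cons 0 y.ofLp : Fin (n + 1) → ℝ)
      map_add' := fun x y => by
        ext i; refine Fin.cases ?_ (fun j => ?_) i <;> simp
      map_smul' := fun c x => by
        ext i; refine Fin.cases ?_ (fun j => ?_) i <;> simp }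

/-- `(t, y) ↦ y`. -/
def bdProj (n : ℕ) : EuclideanSpace ℝ (Fin (n + 1)) →L[ℝ] EuclideanSpace ℝ (Fin n) :=
  LinearMap.toContinuousLinearMap
    { toFun := fun y => WithLp.toLp 2 (Fin.tail y.ofLp)
      map_add' := fun x y => by ext i; simp [Fin.tail]
      map_smul' := fun c x => by ext i; simp [Fin.tail] }

@[simp] lemma bdIncl_zero (y : EuclideanSpace ℝ (Fin n)) : bdIncl n y 0 = 0 := rfl
@[simp] lemma bdIncl_succ (y : EuclideanSpace ℝ (Fin n)) (i : Fin n) :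
    bdIncl n y i.succ = y i := rfl
@[simp] lemma bdProj_apply (y : EuclideanSpace ℝ (Fin (n + 1))) (i : Fin n) :
    bdProj n y i = y i.succ := rfl
@[simp] lemma bdProj_bdIncl (y : EuclideanSpace ℝ (Fin n)) : bdProj n (bdIncl n y) = y := by
  ext i; simp
lemma bdIncl_bdProj {y : EuclideanSpace ℝ (Fin (n + 1))} (hy : y 0 = 0) :
    bdIncl n (bdProj n y) = y := by
  ext i; refine Fin.cases ?_ (fun j => ?_) i <;> simp [hy]

/-- The point `(0, y)` of the half-space. -/
def bdPt (y : EuclideanSpace ℝ (Fin n)) : EuclideanHalfSpace (n + 1) :=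
  ⟨bdIncl n y, (bdIncl_zero y).ge⟩

lemma continuous_bdPt : Continuous (bdPt (n := n)) :=
  (bdIncl n).continuous.subtype_mk _

variable {M : Type*} [TopologicalSpace M] [ChartedSpace (EuclideanHalfSpace (n + 1)) M]

lemma mem_boundary_iff [IsManifold (𝓡∂ (n + 1)) ∞ M] {x q : M}
    (hq : q ∈ (chartAt (EuclideanHalfSpace (n + 1)) x).source) :
    q ∈ (𝓡∂ (n + 1)).boundary M ↔ (chartAt (EuclideanHalfSpace (n + 1)) x q).1 0 = 0 := by
  set e := chartAt (EuclideanHalfSpace (n + 1)) x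
  have h1 := ModelWithCorners.isInteriorPoint_iff_of_mem_atlas (I := 𝓡∂ (n + 1)) (n := ∞)
    (by simp) (chart_mem_atlas (EuclideanHalfSpace (n + 1)) x) hq
  have h2 : e.extend (𝓡∂ (n + 1)) q ∈ interior (e.extend (𝓡∂ (n + 1))).target ↔
      e.extend (𝓡∂ (n + 1)) q ∈ interior (range (𝓡∂ (n + 1))) :=
    ⟨fun h => e.interior_extend_target_subset_interior_range h,
      fun h => e.mem_interior_extend_target (e.map_source hq) h⟩
  rw [h2, interior_range_modelWithCornersEuclideanHalfSpace] at h1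
  have h3 : q ∈ (𝓡∂ (n + 1)).boundary M ↔ ¬ (𝓡∂ (n + 1)).IsInteriorPoint q :=
    ModelWithCorners.isBoundaryPoint_iff_not_isInteriorPoint q
  rw [h3, h1]
  have h4 : (0 : ℝ) ≤ (e q).1 0 := (e q).2
  change ¬ (0 < (e q).1 0) ↔ _
  constructor
  · intro h; linarith
  · intro h; linarith

variable (n M) in
/-- The boundary `∂M`, as a type. -/
abbrev Bd : Type _ := ((𝓡∂ (n + 1)).boundary M : Set M)

variable [IsManifold (𝓡∂ (n + 1)) ∞ M]

lemma symm_bdPt_mem (p : Bd n M) {y : EuclideanSpace ℝ (Fin n)}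
    (hy : bdPt y ∈ (chartAt (EuclideanHalfSpace (n + 1)) p.1).target) :
    (chartAt (EuclideanHalfSpace (n + 1)) p.1).symm (bdPt y) ∈ (𝓡∂ (n + 1)).boundary M := by
  rw [mem_boundary_iff ((chartAt (EuclideanHalfSpace (n + 1)) p.1).map_target hy),
    (chartAt (EuclideanHalfSpace (n + 1)) p.1).right_inv hy]
  rfl

lemma bdPt_bdProj {x : M} (q : Bd n M)
    (hq : q.1 ∈ (chartAt (EuclideanHalfSpace (n + 1)) x).source) :
    bdPt (bdProj n (chartAt (EuclideanHalfSpace (n + 1)) x q.1).1) =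
      chartAt (EuclideanHalfSpace (n + 1)) x q.1 :=
  Subtype.ext (bdIncl_bdProj ((mem_boundary_iff hq).1 q.2))

open Classical in
/-- The inverse of the chart of `∂M` at `p` (with the value `p` off the target). -/
def bdInv (p : Bd n M) (y : EuclideanSpace ℝ (Fin n)) : Bd n M :=
  if h : (chartAt (EuclideanHalfSpace (n + 1)) p.1).symm (bdPt y) ∈ (𝓡∂ (n + 1)).boundary M
  then ⟨_, h⟩ else p

lemma bdInv_val (p : Bd n M) {y : EuclideanSpace ℝ (Fin n)}
    (hy : bdPt y ∈ (chartAt (EuclideanHalfSpace (n + 1)) p.1).target) :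
    (bdInv p y).1 = (chartAt (EuclideanHalfSpace (n + 1)) p.1).symm (bdPt y) := by
  rw [bdInv, dif_pos (symm_bdPt_mem p hy)]

/-- The chart of `∂M` at `p`: the chart of `M` at `p`, restricted to `∂M`, with the vanishing zeroth
coordinate dropped. -/
def bdChart (p : Bd n M) : OpenPartialHomeomorph (Bd n M) (EuclideanSpace ℝ (Fin n)) where
  toFun q := bdProj n (chartAt (EuclideanHalfSpace (n + 1)) p.1 q.1).1
  invFun := bdInv p
  source := {q | q.1 ∈ (chartAt (EuclideanHalfSpace (n + 1)) p.1).source}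
  target := {y | bdPt y ∈ (chartAt (EuclideanHalfSpace (n + 1)) p.1).target}
  map_source' q hq := by
    change bdPt _ ∈ (chartAt (EuclideanHalfSpace (n + 1)) p.1).target
    rw [bdPt_bdProj q hq]
    exact (chartAt _ p.1).map_source hq
  map_target' y hy := by
    change (bdInv p y).1 ∈ (chartAt (EuclideanHalfSpace (n + 1)) p.1).source
    rw [bdInv_val p hy]
    exact (chartAt (EuclideanHalfSpace (n + 1)) p.1).map_target hy
  left_inv' q hq := by
    have h1 := bdPt_bdProj q hq
    apply Subtype.ext
    rw [bdInv_val p (by rw [h1]; exact (chartAt _ p.1).map_source hq), h1]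
    exact (chartAt (EuclideanHalfSpace (n + 1)) p.1).left_inv hq
  right_inv' y hy := by
    rw [bdInv_val p hy, (chartAt (EuclideanHalfSpace (n + 1)) p.1).right_inv hy]
    exact bdProj_bdIncl y
  open_source := (chartAt (EuclideanHalfSpace (n + 1)) p.1).open_source.preimage
    continuous_subtype_val
  open_target := (chartAt (EuclideanHalfSpace (n + 1)) p.1).open_target.preimage continuous_bdPt
  continuousOn_toFun := by
    refine (bdProj n).continuous.comp_continuousOn
      (continuous_subtype_val.comp_continuousOn ?_)
    exact (chartAt (EuclideanHalfSpace (n + 1)) p.1).continuousOn.comp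
      continuous_subtype_val.continuousOn (fun q hq => hq)
  continuousOn_invFun := by
    rw [Topology.IsInducing.subtypeVal.continuousOn_iff]
    exact ((chartAt (EuclideanHalfSpace (n + 1)) p.1).continuousOn_symm.comp
      continuous_bdPt.continuousOn (fun y hy => hy)).congr fun y hy => bdInv_val p hy

instance instChartedSpaceBd : ChartedSpace (EuclideanSpace ℝ (Fin n)) (Bd n M) where
  atlas := range bdChart
  chartAt := bdChart
  mem_chart_source p := mem_chart_source (EuclideanHalfSpace (n + 1)) p.1
  chart_mem_atlas p := mem_range_self p

instance instIsManifoldBd : IsManifold (𝓡 n) ∞ (Bd n M) := by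
  apply isManifold_of_contDiffOn
  rintro _ _ ⟨p, rfl⟩ ⟨q, rfl⟩
  have key := ModelWithCorners.contDiffOn_extendCoordChange (I := 𝓡∂ (n + 1)) (n := ∞)
    (IsManifold.subset_maximalAtlas (chart_mem_atlas (EuclideanHalfSpace (n + 1)) p.1))
    (IsManifold.subset_maximalAtlas (chart_mem_atlas (EuclideanHalfSpace (n + 1)) q.1))
  rw [ModelWithCorners.extendCoordChange_source] at key
  refine (((bdProj n).contDiff.comp_contDiffOn key).comp (bdIncl n).contDiff.contDiffOn
    (s := ((𝓡 n).symm ⁻¹' ((bdChart p).symm ≫ₕ bdChart q).source ∩ range (𝓡 n))) ?_).congr ?_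
  · rintro y ⟨⟨hy, hy'⟩, -⟩
    replace hy : bdPt y ∈ (chartAt (EuclideanHalfSpace (n + 1)) p.1).target := hy
    have hy' : (bdInv p y).1 ∈ (chartAt (EuclideanHalfSpace (n + 1)) q.1).source := hy'
    rw [bdInv_val p hy] at hy'
    exact ⟨bdPt y, ⟨hy, hy'⟩, rfl⟩
  · rintro y ⟨⟨hy, -⟩, -⟩
    replace hy : bdPt y ∈ (chartAt (EuclideanHalfSpace (n + 1)) p.1).target := hy
    change bdProj n (chartAt (EuclideanHalfSpace (n + 1)) q.1 (bdInv p y).1).1 =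
      bdProj n (chartAt (EuclideanHalfSpace (n + 1)) q.1
        ((chartAt (EuclideanHalfSpace (n + 1)) p.1).symm ((𝓡∂ (n + 1)).symm (bdIncl n y)))).1
    have h : (𝓡∂ (n + 1)).symm (bdIncl n y) = bdPt y := (𝓡∂ (n + 1)).left_inv (bdPt y)
    rw [bdInv_val p hy, h]

lemma contMDiff_bdVal : ContMDiff (𝓡 n) (𝓡∂ (n + 1)) ∞ (Subtype.val : Bd n M → M) := by
  intro p
  rw [contMDiffAt_iff]
  refine ⟨continuous_subtype_val.continuousAt, ?_⟩
  have hT : (bdChart p).target ∈ nhds (extChartAt (𝓡 n) p p) :=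
    (bdChart p).open_target.mem_nhds ((bdChart p).map_source (mem_chart_source _ p))
  refine ((bdIncl n).contDiff.contDiffAt.congr_of_eventuallyEq ?_).contDiffWithinAt
  filter_upwards [hT] with y hy
  change (chartAt (EuclideanHalfSpace (n + 1)) p.1 (bdInv p y).1).1 = bdIncl n y
  rw [bdInv_val p hy, (chartAt (EuclideanHalfSpace (n + 1)) p.1).right_inv hy]
  rfl

lemma mfderiv_bdVal (p : Bd n M) :
    mfderiv (𝓡 n) (𝓡∂ (n + 1)) (Subtype.val : Bd n M → M) p = bdIncl n := by
  have hT : (bdChart p).target ∈ nhds (extChartAt (𝓡 n) p p) :=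
    (bdChart p).open_target.mem_nhds ((bdChart p).map_source (mem_chart_source _ p))
  rw [((contMDiff_bdVal p).mdifferentiableAt (by simp)).mfderiv]
  have : fderivWithin ℝ (bdIncl n) (range (𝓡 n)) (extChartAt (𝓡 n) p p) = bdIncl n := by
    simp
  rw [← this]
  refine Filter.EventuallyEq.fderivWithin_eq_of_nhds ?_
  filter_upwards [hT] with y hy
  change (chartAt (EuclideanHalfSpace (n + 1)) p.1 (bdInv p y).1).1 = bdIncl n y
  rw [bdInv_val p hy, (chartAt (EuclideanHalfSpace (n + 1)) p.1).right_inv hy]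
  rfl

lemma bdIncl_injective : Injective (bdIncl n) :=
  LeftInverse.injective (g := bdProj n) bdProj_bdIncl

/-- The bilinear form on `T_p ∂M` induced by a bilinear form `B` on `T_p M`:
`(v, w) ↦ B (dι v) (dι w)`, where `ι : ∂M → M` is the inclusion. -/
def inducedForm (p : Bd n M)
    (B : TangentSpace (𝓡∂ (n + 1)) p.1 →L[ℝ] TangentSpace (𝓡∂ (n + 1)) p.1 →L[ℝ] ℝ) :
    TangentSpace (𝓡 n) p →L[ℝ] TangentSpace (𝓡 n) p →L[ℝ] ℝ :=
  ContinuousLinearMap.bilinearComp (E := EuclideanSpace ℝ (Fin (n + 1)))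
    (F := EuclideanSpace ℝ (Fin (n + 1))) (E' := EuclideanSpace ℝ (Fin n))
    (F' := EuclideanSpace ℝ (Fin n)) B
    (mfderiv (𝓡 n) (𝓡∂ (n + 1)) (Subtype.val : Bd n M → M) p)
    (mfderiv (𝓡 n) (𝓡∂ (n + 1)) (Subtype.val : Bd n M → M) p)

lemma inducedForm_apply (p : Bd n M)
    (B : TangentSpace (𝓡∂ (n + 1)) p.1 →L[ℝ] TangentSpace (𝓡∂ (n + 1)) p.1 →L[ℝ] ℝ)
    (v w : TangentSpace (𝓡 n) p) :
    inducedForm p B v w = B (mfderiv (𝓡 n) (𝓡∂ (n + 1)) (Subtype.val : Bd n M → M) p v)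
      (mfderiv (𝓡 n) (𝓡∂ (n + 1)) (Subtype.val : Bd n M → M) p w) := rfl

/-- The Riemannian metric on `∂M` induced by a Riemannian metric on `M`. -/
def inducedMetric
    (g : Bundle.ContMDiffRiemannianMetric (𝓡∂ (n + 1)) ∞ (EuclideanSpace ℝ (Fin (n + 1)))
      (fun x : M => TangentSpace (𝓡∂ (n + 1)) x)) :
    Bundle.ContMDiffRiemannianMetric (𝓡 n) ∞ (EuclideanSpace ℝ (Fin n))
      (fun p : Bd n M => TangentSpace (𝓡 n) p) where
  inner p := inducedForm p (g.inner p.1)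
  symm p v w := g.symm _ _ _
  pos p v hv := by
    rw [inducedForm_apply]
    refine g.pos _ _ fun h => hv ?_
    rw [mfderiv_bdVal] at h
    exact bdIncl_injective (h.trans (map_zero (bdIncl n)).symm)
  isVonNBounded p := by
    have h : Bornology.IsVonNBounded ℝ
        (bdProj n '' {v : EuclideanSpace ℝ (Fin (n + 1)) | g.inner p.1 v v < 1}) :=
      (g.isVonNBounded p.1).image (bdProj n)
    have h' : {v : EuclideanSpace ℝ (Fin n) | inducedForm p (g.inner p.1) v v < 1} ⊆
        bdProj n '' {v : EuclideanSpace ℝ (Fin (n + 1)) | g.inner p.1 v v < 1} := by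
      intro v hv
      refine ⟨bdIncl n v, ?_, bdProj_bdIncl v⟩
      have hv' := (inducedForm_apply p (g.inner p.1) v v).symm.trans_lt hv
      rw [mfderiv_bdVal] at hv'
      exact hv'
    exact h.subset h'
  contMDiff := by
    intro p₀
    have h1 := (g.contMDiff p₀.1).comp p₀ (contMDiff_bdVal p₀)
    have h2 := ContMDiffAt.mfderiv_const (m := ∞) (contMDiff_bdVal (n := n) (M := M) p₀) (by simp)
    rw [contMDiffAt_hom_bundle] at h1 ⊢
    refine ⟨contMDiffAt_id, ?_⟩
    refine ((contDiff_bilinearComp).contDiffAt.comp_contMDiffAt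
      (h1.2.prodMk_space h2)).congr_of_eventuallyEq ?_
    have hN : (trivializationAt (EuclideanSpace ℝ (Fin n))
        (TangentSpace (𝓡 n) : Bd n M → Type) p₀).baseSet ∈ nhds p₀ :=
      (trivializationAt _ _ p₀).open_baseSet.mem_nhds (FiberBundle.mem_baseSet_trivializationAt' p₀)
    have hM : (trivializationAt (EuclideanSpace ℝ (Fin (n + 1)))
        (TangentSpace (𝓡∂ (n + 1)) : M → Type) p₀.1).baseSet ∈ nhds p₀.1 :=
      (trivializationAt _ _ p₀.1).open_baseSet.mem_nhds
        (FiberBundle.mem_baseSet_trivializationAt' p₀.1)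
    filter_upwards [hN, continuous_subtype_val.continuousAt hM] with p hp hpM
    ext v w
    rw [inCoordinates_apply_eq₂ hp hp (by simp)]
    simp only [Function.comp_apply, ContinuousLinearMap.bilinearComp_apply]
    erw [inCoordinates_apply_eq₂ hpM hpM (by simp)]
    have hA : ∀ u : EuclideanSpace ℝ (Fin n),
        (trivializationAt (EuclideanSpace ℝ (Fin (n + 1)))
          (TangentSpace (𝓡∂ (n + 1)) : M → Type) p₀.1).symm p.1
          (inTangentCoordinates (𝓡 n) (𝓡∂ (n + 1)) id (Subtype.val : Bd n M → M)
            (mfderiv (𝓡 n) (𝓡∂ (n + 1)) (Subtype.val : Bd n M → M)) p₀ p u) =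
        mfderiv (𝓡 n) (𝓡∂ (n + 1)) (Subtype.val : Bd n M → M) p
          ((trivializationAt (EuclideanSpace ℝ (Fin n))
            (TangentSpace (𝓡 n) : Bd n M → Type) p₀).symm p u) := by
      intro u
      have h := Bundle.Trivialization.symmL_continuousLinearMapAt (R := ℝ)
        (trivializationAt (EuclideanSpace ℝ (Fin (n + 1)))
          (TangentSpace (𝓡∂ (n + 1)) : M → Type) p₀.1) hpM
        (mfderiv (𝓡 n) (𝓡∂ (n + 1)) (Subtype.val : Bd n M → M) p
          ((trivializationAt (EuclideanSpace ℝ (Fin n))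
            (TangentSpace (𝓡 n) : Bd n M → Type) p₀).symm p u))
      unfold inTangentCoordinates ContinuousLinearMap.inCoordinates
      rw [Bundle.Trivialization.symmL_apply _ hpM] at h
      erw [ContinuousLinearMap.comp_apply, ContinuousLinearMap.comp_apply,
        Bundle.Trivialization.symmL_apply _ hp]
      exact h
    rw [inducedForm_apply, hA, hA]
    rfl

end Boundary

/-! ### The unit normal, the second fundamental form, and the geodesic collar -/

section Normal

variable {n : ℕ}

/-- The inward unit normal of the hyperplane `{y₀ = 0}` for an inner product `B`: the normalized
`B`-gradient of the coordinate `y₀` (see `inwardNormal_spec`). -/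
def inwardNormal (B : EuclideanSpace ℝ (Fin (n + 1)) →L[ℝ] EuclideanSpace ℝ (Fin (n + 1)) →L[ℝ] ℝ) :
    EuclideanSpace ℝ (Fin (n + 1)) :=
  (√(B.inverse (EuclideanSpace.proj 0) 0))⁻¹ • B.inverse (EuclideanSpace.proj 0)

lemma apply_inverse_of_pos {E : Type*} [NormedAddCommGroup E] [NormedSpace ℝ E]
    [FiniteDimensional ℝ E] (B : E →L[ℝ] E →L[ℝ] ℝ) (hB : ∀ v, v ≠ 0 → 0 < B v v)
    (f : E →L[ℝ] ℝ) : B (B.inverse f) = f := by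
  have hinj : Injective B := by
    rw [injective_iff_map_eq_zero]
    intro v hv
    by_contra h
    have := hB v h
    rw [hv] at this
    exact lt_irrefl _ this
  have hdim : Module.finrank ℝ E = Module.finrank ℝ (E →L[ℝ] ℝ) :=
    Subspace.dual_finrank_eq.symm.trans
      (LinearMap.toContinuousLinearMap : (E →ₗ[ℝ] ℝ) ≃ₗ[ℝ] E →L[ℝ] ℝ).finrank_eq
  let e : E ≃L[ℝ] (E →L[ℝ] ℝ) :=
    (LinearEquiv.ofInjectiveOfFinrankEq (B : E →ₗ[ℝ] E →L[ℝ] ℝ) hinj hdim).toContinuousLinearEquiv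
  have he : (e : E →L[ℝ] E →L[ℝ] ℝ) = B := by ext; rfl
  rw [← he, ContinuousLinearMap.inverse_equiv]
  exact e.apply_symm_apply f

lemma inwardNormal_spec
    (B : EuclideanSpace ℝ (Fin (n + 1)) →L[ℝ] EuclideanSpace ℝ (Fin (n + 1)) →L[ℝ] ℝ)
    (hB : ∀ v, v ≠ 0 → 0 < B v v) :
    (∀ v, B (inwardNormal B) (bdIncl n v) = 0) ∧ B (inwardNormal B) (inwardNormal B) = 1 ∧
      0 < inwardNormal B 0 := by
  set a : EuclideanSpace ℝ (Fin (n + 1)) := B.inverse (EuclideanSpace.proj 0) with ha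
  have h1 : B a = EuclideanSpace.proj 0 := apply_inverse_of_pos B hB _
  have ha0 : a ≠ 0 := by
    intro h
    have h2 : B a (EuclideanSpace.single 0 1) = 1 := by rw [h1]; simp
    rw [h] at h2
    simp at h2
  have hpos : 0 < a 0 := by
    have := hB a ha0
    rw [h1] at this
    exact this
  have hs : 0 < √(a 0) := Real.sqrt_pos.2 hpos
  have hν : inwardNormal B = (√(a 0))⁻¹ • a := rfl
  refine ⟨fun v => ?_, ?_, ?_⟩
  · rw [hν, map_smul, smul_apply, h1]
    simp
  · rw [hν]
    simp only [map_smul, smul_apply, h1, smul_eq_mul]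
    change (√(a 0))⁻¹ * ((√(a 0))⁻¹ * a 0) = 1
    rw [← mul_assoc, ← mul_inv, Real.mul_self_sqrt hpos.le, inv_mul_cancel₀ hpos.ne']
  · rw [hν]
    simp only [PiLp.smul_apply, smul_eq_mul]
    positivity

variable {M : Type*} [TopologicalSpace M] [ChartedSpace (EuclideanHalfSpace (n + 1)) M]
  [IsManifold (𝓡∂ (n + 1)) ∞ M]
  (g : Bundle.ContMDiffRiemannianMetric (𝓡∂ (n + 1)) ∞ (EuclideanSpace ℝ (Fin (n + 1)))
    (fun x : M => TangentSpace (𝓡∂ (n + 1)) x))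

/-- The inward unit normal `ν_p ∈ T_p M` at a boundary point `p`. -/
def unitNormal (p : Bd n M) : TangentSpace (𝓡∂ (n + 1)) p.1 :=
  inwardNormal (g.inner p.1)

/-- The second fundamental form `l(X, Y) = g(∇_X Y, ν)` of `∂M`, in the chart of `∂M` at `p`. -/
def secondForm (p : Bd n M) (y : EuclideanSpace ℝ (Fin n))
    (v : Fin 2 → EuclideanSpace ℝ (Fin n)) : ℝ :=
  chartMetric (𝓡∂ (n + 1)) g p.1 (bdIncl n y)
    (christoffel (range (𝓡∂ (n + 1))) (chartMetric (𝓡∂ (n + 1)) g p.1) (bdIncl n y)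
      (bdIncl n (v 0)) (bdIncl n (v 1)))
    (inwardNormal (chartMetric (𝓡∂ (n + 1)) g p.1 (bdIncl n y)))

/-- The tensor `∇̄^i l` at `p ∈ ∂M`, where `∇̄` is the Levi-Civita connection of `∂M`, computed in
the chart of `∂M` at `p`. -/
def nablaL (i : ℕ) (p : Bd n M) : (Fin (2 + i) → TangentSpace (𝓡 n) p) → ℝ :=
  iterCovDeriv (range (𝓡 n)) (chartMetric (𝓡 n) (inducedMetric g) p) (secondForm g p) i
    (extChartAt (𝓡 n) p p)

/-- The pointwise norm `|∇̄^i l|` at `p ∈ ∂M`. -/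
def normNablaL (i : ℕ) (p : Bd n M) : ℝ≥0∞ :=
  tensorNorm (E := EuclideanSpace ℝ (Fin n)) ((inducedMetric g).inner p) (nablaL g i p)

/-- The set `N(s) = {exp_p (t ν_p) | p ∈ ∂M, 0 ≤ t ≤ s}`. -/
def collarSet (s : ℝ) : Set M :=
  {y | ∃ p : Bd n M, ∃ t ∈ Icc 0 s, IsExp (𝓡∂ (n + 1)) g p.1 (t • unitNormal g p) y}

/-- The geodesic collar `∂M × [0, r) → M`, `(p, t) ↦ exp_p (t ν_p)`, is defined and a diffeomorphism
onto its image. -/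
def IsNormalCollar (r : ℝ) : Prop :=
  ∃ K : Bd n M × ℝ → M,
    (∀ p : Bd n M, ∀ t ∈ Ico 0 r, IsExp (𝓡∂ (n + 1)) g p.1 (t • unitNormal g p) (K (p, t))) ∧
    IsDiffeoOntoImageOn (𝓡∂ (n + 1)) ((𝓡 n).prod 𝓘(ℝ, ℝ)) K (univ ×ˢ Ico 0 r)

/-- A Riemannian manifold `(M, g)` of dimension `n + 1` with (possibly empty) boundary has
(coordinate-free) bounded geometry. -/
structure BoundedGeometry : Prop where
  /-- Normal collar. -/
  collar : ∃ rC > 0, IsNormalCollar g rC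
  /-- The injectivity radius of the boundary is positive. -/
  inj_boundary : 0 < injectivityRadius (𝓡 n) (inducedMetric g)
  /-- Injectivity radius of `M`. -/
  inj : ∃ ri > 0, ∀ r, 0 < r → r ≤ ri → ∀ x ∉ collarSet g r, ExpDiffeoOnBall (𝓡∂ (n + 1)) g x r
  /-- Curvature bounds. -/
  curv : ∀ k : ℕ, ∃ C : ℝ, 0 < C ∧ ∀ i ≤ k,
    (∀ x : M, normNablaR (𝓡∂ (n + 1)) g i x ≤ ENNReal.ofReal C) ∧
    (∀ p : Bd n M, normNablaL g i p ≤ ENNReal.ofReal C)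

end Normal

/-- A Riemannian manifold `(N, g)` of dimension `n` without boundary has bounded geometry. This is
the case `∂N = ∅` of the definition for manifolds with boundary: the conditions on the collar, on the
injectivity radius of `∂N` and on the second fundamental form are void, and `N(r) = ∅`. -/
structure BoundedGeometryWithoutBoundary {n : ℕ} {N : Type*} [TopologicalSpace N]
    [ChartedSpace (EuclideanSpace ℝ (Fin n)) N] [IsManifold (𝓡 n) ∞ N]
    (g : Bundle.ContMDiffRiemannianMetric (𝓡 n) ∞ (EuclideanSpace ℝ (Fin n))
      (fun x : N => TangentSpace (𝓡 n) x)) : Prop where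
  /-- Injectivity radius of `N`. -/
  inj : ∃ ri > 0, ∀ r, 0 < r → r ≤ ri → ∀ x, ExpDiffeoOnBall (𝓡 n) g x r
  /-- Curvature bounds. -/
  curv : ∀ k : ℕ, ∃ C : ℝ, 0 < C ∧ ∀ i ≤ k, ∀ x : N, normNablaR (𝓡 n) g i x ≤ ENNReal.ofReal C

end BddGeom
end

noncomputable section
namespace BddGeom

set_option maxSynthPendingDepth 3
set_option linter.unusedSectionVars false

/-! ### Calculus of connections on trivial bundles -/

/-! Positivity of the injectivity radius of `∂M` is part of the hypothesis, and it gives one radius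
for all points because the exponential map stays a diffeomorphism on smaller balls
(`exists_expDiffeoOnBall`). The content is the bound for the derivatives of the curvature `R̄` of
`∂M`. It is a pointwise estimate: in a chart of `M` the boundary is a hyperplane with a linear
inclusion `ι` (`isHypersurface_boundary`), so one computes with connections on trivial bundles over
a coordinate domain.

Regard `ι` as a section of `Hom(T∂M, TM|∂M)`. Its covariant derivative is the vector valued second
fundamental form `b`, and antisymmetrizing its second derivative gives a Ricci identity `R(u, v)w -
ι R̄(u, v)w = (∇b)(u, v, w) - (∇b)(v, u, w)`, which contains both the Gauss and the Codazzi equation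
(`gauss_codazzi`). Gauss' formula says `b = l ν` (`secondVec_eq`), and Weingarten's says `∇ν = ι ∘
S`, where `S` is `-l` with an index raised (`weingarten`). So `(ι, ν)` solves a closed linear system
with coefficients `l`, and induction bounds all derivatives of `ι` and `ν` by those of `l`
(`normCov_frame_le`). The derivative of a restricted ambient tensor is the restricted ambient
derivative composed with `ι`, which carries the bounds for `∇^j R` over to the boundary
(`normCov_restrict_le`). Together these bound `∇̄^i R̄` (`normCov_curvatureL_le`).

Two principles control the norms: a parallel bilinear bundle map of norm at most one costs a factor
`2 ^ i` at order `i` (`normCov_bilin_le`), and a parallel isometric bundle map costs nothing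
(`IsometryCompat.normCov_eq`). The constants involve only `i` and the given bounds, hence are
uniform in the point. `IsEval.normCov_eq` translates bundle valued derivatives into the coordinate
tensors of the definition. -/

/-- A connection on the trivial bundle with fibre `W` over (a subset of) `V`, with coefficients `A`,
and a norm on the fibre over a base point. -/
structure Conn (V W : Type) [NormedAddCommGroup V] [NormedSpace ℝ V]
    [NormedAddCommGroup W] [NormedSpace ℝ W] where
  A : V → V →L[ℝ] W →L[ℝ] W
  N : W → ℝ≥0∞

namespace Conn

variable {V U W W₁ W₂ W₃ : Type} [NormedAddCommGroup V] [NormedSpace ℝ V]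
  [NormedAddCommGroup U] [NormedSpace ℝ U] [NormedAddCommGroup W] [NormedSpace ℝ W]
  [NormedAddCommGroup W₁] [NormedSpace ℝ W₁] [NormedAddCommGroup W₂] [NormedSpace ℝ W₂]
  [NormedAddCommGroup W₃] [NormedSpace ℝ W₃]

/-- The bundle of homomorphisms. -/
def hom (X : Conn V U) (Y : Conn V W) : Conn V (U →L[ℝ] W) where
  A y := (ContinuousLinearMap.compL ℝ U W W).comp (Y.A y)
    - (ContinuousLinearMap.compL ℝ U U W).flip.comp (X.A y)
  N f := ⨆ (u : U) (_ : X.N u ≤ 1), Y.N (f u)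

@[simp] lemma hom_A_apply (X : Conn V U) (Y : Conn V W) (y x : V) (f : U →L[ℝ] W) (u : U) :
    (hom X Y).A y x f u = Y.A y x (f u) - f (X.A y x u) := rfl

/-- The trivial line bundle. -/
def triv (V : Type) [NormedAddCommGroup V] [NormedSpace ℝ V] : Conn V ℝ where
  A _ := 0
  N r := ENNReal.ofReal |r|

@[simp] lemma triv_A (y : V) : (triv V).A y = 0 := rfl

/-- The covariant derivative of a section. -/
def covD (Ω : Set V) (X : Conn V W) (s : V → W) (y : V) : V →L[ℝ] W :=
  fderivWithin ℝ s Ω y + (X.A y).flip (s y)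

lemma covD_apply (Ω : Set V) (X : Conn V W) (s : V → W) (y x : V) :
    covD Ω X s y x = fderivWithin ℝ s Ω y x + X.A y x (s y) := rfl

/-- The norm at `y₀` of the `i`-th iterated covariant derivative of a section of `X`, for the
connection `T` on the tangent bundle of the base. -/
def normCov (Ω : Set V) (T : Conn V V) (y₀ : V) :
    (i : ℕ) → {W : Type} → [NormedAddCommGroup W] → [NormedSpace ℝ W] → Conn V W → (V → W) → ℝ≥0∞
  | 0, _, _, _, X, s => X.N (s y₀)
  | i + 1, _, _, _, X, s => normCov Ω T y₀ i (hom T X) (covD Ω X s)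

/-- The coefficients of the connection are smooth. -/
def Smooth (Ω : Set V) (X : Conn V W) : Prop := ContDiffOn ℝ ∞ X.A Ω

/-- The fibre norm is subadditive and absolutely homogeneous. -/
structure Normed (X : Conn V W) : Prop where
  add_le : ∀ a b, X.N (a + b) ≤ X.N a + X.N b
  smul : ∀ (c : ℝ) a, X.N (c • a) = ENNReal.ofReal |c| * X.N a

lemma Normed.zero {X : Conn V W} (h : Normed X) : X.N 0 = 0 := by
  have := h.smul 0 0
  simpa using this

lemma Normed.hom (X : Conn V U) {Y : Conn V W} (h : Normed Y) : Normed (hom X Y) where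
  add_le a b := by
    refine iSup₂_le fun u hu => (h.add_le _ _).trans (add_le_add ?_ ?_)
    · exact le_iSup₂ (f := fun u (_ : X.N u ≤ 1) => Y.N (a u)) u hu
    · exact le_iSup₂ (f := fun u (_ : X.N u ≤ 1) => Y.N (b u)) u hu
  smul c a := by
    simp only [Conn.hom, smul_apply, h.smul, ENNReal.mul_iSup]

lemma normed_triv : Normed (triv V) where
  add_le a b := by
    change ENNReal.ofReal |a + b| ≤ ENNReal.ofReal |a| + ENNReal.ofReal |b|
    rw [← ENNReal.ofReal_add (abs_nonneg a) (abs_nonneg b)]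
    exact ENNReal.ofReal_le_ofReal (abs_add_le a b)
  smul c a := by
    change ENNReal.ofReal |c * a| = ENNReal.ofReal |c| * ENNReal.ofReal |a|
    rw [abs_mul, ENNReal.ofReal_mul (abs_nonneg c)]

/-- A norm that is finite and definite. -/
structure Definite (X : Conn V W) : Prop extends Normed X where
  ne_top : ∀ a, X.N a ≠ ⊤
  ne_zero : ∀ a, a ≠ 0 → X.N a ≠ 0

/-- Rescale `u` to length one; this needs the norm on the source to be finite and definite. -/
lemma le_hom_mul {X : Conn V U} {Y : Conn V W} (hX : Definite X) (hY : Normed Y) (f : U →L[ℝ] W)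
    (u : U) : Y.N (f u) ≤ (hom X Y).N f * X.N u := by
  rcases eq_or_ne u 0 with rfl | hu
  · simp [hY.zero]
  · set r : ℝ := (X.N u).toReal
    have hr : ENNReal.ofReal r = X.N u := ENNReal.ofReal_toReal (hX.ne_top u)
    have hr0 : 0 < r := ENNReal.toReal_pos (hX.ne_zero u hu) (hX.ne_top u)
    have h1 : X.N (r⁻¹ • u) ≤ 1 := by
      rw [hX.smul, ← hr, abs_of_pos (inv_pos.2 hr0), ← ENNReal.ofReal_mul (inv_pos.2 hr0).le,
        inv_mul_cancel₀ hr0.ne', ENNReal.ofReal_one]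
    have h2 : Y.N (f (r⁻¹ • u)) ≤ (Conn.hom X Y).N f :=
      le_iSup₂ (f := fun u (_ : X.N u ≤ 1) => Y.N (f u)) _ h1
    calc Y.N (f u) = Y.N (r • f (r⁻¹ • u)) := by
          rw [map_smul, smul_smul, mul_inv_cancel₀ hr0.ne', one_smul]
      _ = X.N u * Y.N (f (r⁻¹ • u)) := by rw [hY.smul, abs_of_pos hr0, hr]
      _ ≤ _ := by rw [mul_comm]; gcongr

/-! ### Smoothness of connections and of covariant derivatives -/

section Regularity
variable {Ω : Set V}

lemma Smooth.hom {X : Conn V U} {Y : Conn V W} (hX : Smooth Ω X) (hY : Smooth Ω Y) :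
    Smooth Ω (hom X Y) := by
  have h1 : ContDiffOn ℝ ∞ (fun y => (ContinuousLinearMap.compL ℝ U W W).comp (Y.A y)) Ω :=
    contDiffOn_const.clm_comp hY
  have h2 : ContDiffOn ℝ ∞ (fun y => (ContinuousLinearMap.compL ℝ U U W).flip.comp (X.A y)) Ω :=
    contDiffOn_const.clm_comp hX
  exact h1.sub h2

lemma smooth_triv : Smooth Ω (triv V) := contDiffOn_const

lemma contDiffOn_flip {f : V → U →L[ℝ] W₁ →L[ℝ] W₂} (hf : ContDiffOn ℝ ∞ f Ω) :
    ContDiffOn ℝ ∞ (fun y => (f y).flip) Ω :=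
  (ContinuousLinearMap.flipₗᵢ ℝ U W₁ W₂).contDiff.comp_contDiffOn hf

lemma contDiffOn_covD (hΩ : UniqueDiffOn ℝ Ω) {X : Conn V W} (hX : Smooth Ω X) {s : V → W}
    (hs : ContDiffOn ℝ ∞ s Ω) : ContDiffOn ℝ ∞ (covD Ω X s) Ω :=
  (hs.fderivWithin hΩ (by simp)).add ((contDiffOn_flip hX).clm_apply hs)

end Regularity

/-! ### Leibniz estimates, parallel bilinear maps and parallel isometries -/

section Bounds
variable {Ω : Set V} {T : Conn V V} {y₀ : V}

lemma covD_congr (X : Conn V W) {s t : V → W} (h : EqOn s t Ω) :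
    EqOn (covD Ω X s) (covD Ω X t) Ω := by
  intro y hy
  simp only [covD, fderivWithin_congr h (h hy), h hy]

lemma normCov_congr (hy₀ : y₀ ∈ Ω) (i : ℕ) (X : Conn V W) {s t : V → W} (h : EqOn s t Ω) :
    normCov Ω T y₀ i X s = normCov Ω T y₀ i X t := by
  induction i generalizing W with
  | zero => simp only [normCov, h hy₀]
  | succ i ih => exact ih _ (covD_congr X h)

lemma covD_add (hΩ : UniqueDiffOn ℝ Ω) (X : Conn V W) {s t : V → W} (hs : ContDiffOn ℝ ∞ s Ω)
    (ht : ContDiffOn ℝ ∞ t Ω) :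
    EqOn (covD Ω X (fun y => s y + t y)) (fun y => covD Ω X s y + covD Ω X t y) Ω := by
  intro y hy
  have := fderivWithin_add (hΩ y hy) ((hs.differentiableOn (by simp)) y hy)
    ((ht.differentiableOn (by simp)) y hy)
  ext x
  simp only [covD_apply, add_apply, map_add]
  rw [show (fun y => s y + t y) = s + t from rfl, this]
  simp only [add_apply]
  abel

lemma normCov_add_le (hΩ : UniqueDiffOn ℝ Ω) (hy₀ : y₀ ∈ Ω) (hT : Smooth Ω T) (i : ℕ)
    {X : Conn V W} (hX : Smooth Ω X) (hN : Normed X) {s t : V → W} (hs : ContDiffOn ℝ ∞ s Ω)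
    (ht : ContDiffOn ℝ ∞ t Ω) :
    normCov Ω T y₀ i X (fun y => s y + t y) ≤ normCov Ω T y₀ i X s + normCov Ω T y₀ i X t := by
  induction i generalizing W with
  | zero => exact hN.add_le _ _
  | succ i ih =>
    simp only [normCov]
    rw [normCov_congr hy₀ i _ (covD_add hΩ X hs ht)]
    exact ih (hT.hom hX) (Normed.hom T hN) (contDiffOn_covD hΩ hX hs) (contDiffOn_covD hΩ hX ht)

/-- A bilinear bundle map is parallel and has norm at most one. -/
structure BilinCompat (Ω : Set V) (X : Conn V W₁) (Y : Conn V W₂) (Z : Conn V W₃)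
    (β : W₁ →L[ℝ] W₂ →L[ℝ] W₃) : Prop where
  parallel : ∀ y ∈ Ω, ∀ x a b, Z.A y x (β a b) = β (X.A y x a) b + β a (Y.A y x b)
  norm_le : ∀ a b, Z.N (β a b) ≤ X.N a * Y.N b

/-- The extension of a bilinear map `β` to homomorphisms into the first factor. -/
def liftLeft (U : Type) [NormedAddCommGroup U] [NormedSpace ℝ U] (β : W₁ →L[ℝ] W₂ →L[ℝ] W₃) :
    (U →L[ℝ] W₁) →L[ℝ] W₂ →L[ℝ] (U →L[ℝ] W₃) :=
  ((ContinuousLinearMap.compL ℝ U W₁ W₃).comp β.flip).flip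

@[simp] lemma liftLeft_apply (β : W₁ →L[ℝ] W₂ →L[ℝ] W₃) (f : U →L[ℝ] W₁) (b : W₂) (u : U) :
    liftLeft U β f b u = β (f u) b := rfl

/-- The extension of a bilinear map `β` to homomorphisms into the second factor. -/
def liftRight (U : Type) [NormedAddCommGroup U] [NormedSpace ℝ U] (β : W₁ →L[ℝ] W₂ →L[ℝ] W₃) :
    W₁ →L[ℝ] (U →L[ℝ] W₂) →L[ℝ] (U →L[ℝ] W₃) :=
  (ContinuousLinearMap.compL ℝ U W₂ W₃).comp β

@[simp] lemma liftRight_apply (β : W₁ →L[ℝ] W₂ →L[ℝ] W₃) (a : W₁) (f : U →L[ℝ] W₂) (u : U) :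
    liftRight U β a f u = β a (f u) := rfl

lemma BilinCompat.liftLeft {X : Conn V W₁} {Y : Conn V W₂} {Z : Conn V W₃}
    {β : W₁ →L[ℝ] W₂ →L[ℝ] W₃} (h : BilinCompat Ω X Y Z β) (Q : Conn V U) :
    BilinCompat Ω (hom Q X) Y (hom Q Z) (liftLeft U β) where
  parallel y hy x f b := by
    ext u
    simp only [hom_A_apply, liftLeft_apply, add_apply, h.parallel y hy, map_sub, sub_apply]
    abel
  norm_le f b := by
    refine iSup₂_le fun u hu => (h.norm_le _ _).trans ?_
    gcongr
    exact le_iSup₂ (f := fun u (_ : Q.N u ≤ 1) => X.N (f u)) u hu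

lemma BilinCompat.liftRight {X : Conn V W₁} {Y : Conn V W₂} {Z : Conn V W₃}
    {β : W₁ →L[ℝ] W₂ →L[ℝ] W₃} (h : BilinCompat Ω X Y Z β) (Q : Conn V U) :
    BilinCompat Ω X (hom Q Y) (hom Q Z) (liftRight U β) where
  parallel y hy x a f := by
    ext u
    simp only [hom_A_apply, liftRight_apply, add_apply, h.parallel y hy, map_sub]
    abel
  norm_le a f := by
    refine iSup₂_le fun u hu => (h.norm_le _ _).trans ?_
    gcongr
    exact le_iSup₂ (f := fun u (_ : Q.N u ≤ 1) => Y.N (f u)) u hu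

lemma contDiffOn_bilin (β : W₁ →L[ℝ] W₂ →L[ℝ] W₃) {s : V → W₁} {t : V → W₂}
    (hs : ContDiffOn ℝ ∞ s Ω) (ht : ContDiffOn ℝ ∞ t Ω) :
    ContDiffOn ℝ ∞ (fun y => β (s y) (t y)) Ω :=
  (β.contDiff.comp_contDiffOn hs).clm_apply ht

/-- Leibniz rule. Parallelism of `β` distributes the connection terms over the two factors, and both
summands are again values of parallel bilinear maps of norm at most one, so the rule can be
iterated. -/
lemma covD_bilin (hΩ : UniqueDiffOn ℝ Ω) {X : Conn V W₁} {Y : Conn V W₂} {Z : Conn V W₃}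
    {β : W₁ →L[ℝ] W₂ →L[ℝ] W₃} (h : BilinCompat Ω X Y Z β) {s : V → W₁} {t : V → W₂}
    (hs : ContDiffOn ℝ ∞ s Ω) (ht : ContDiffOn ℝ ∞ t Ω) :
    EqOn (covD Ω Z (fun y => β (s y) (t y)))
      (fun y => Conn.liftLeft V β (covD Ω X s y) (t y) + Conn.liftRight V β (s y) (covD Ω Y t y))
      Ω := by
  intro y hy
  have hs' := (hs.differentiableOn (by simp) y hy).hasFDerivWithinAt
  have ht' := (ht.differentiableOn (by simp) y hy).hasFDerivWithinAt
  have := ((β.hasFDerivAt.comp_hasFDerivWithinAt y hs').clm_apply ht').fderivWithin (hΩ y hy)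
  ext x
  simp only [Function.comp_apply] at this
  simp only [covD_apply, this, h.parallel y hy, add_apply, liftLeft_apply, liftRight_apply,
    ContinuousLinearMap.comp_apply, ContinuousLinearMap.flip_apply, map_add]
  abel

/-- Each derivative splits a product into two products of the same kind, whence `2 ^ i`. The
derivatives may fall on either factor, so all orders up to `i` must be bounded; the fibres vary in
the induction because differentiating changes the bundle. -/
lemma normCov_bilin_le (hΩ : UniqueDiffOn ℝ Ω) (hy₀ : y₀ ∈ Ω) (hT : Smooth Ω T) (i : ℕ)
    {X : Conn V W₁} {Y : Conn V W₂} {Z : Conn V W₃} (hX : Smooth Ω X) (hY : Smooth Ω Y)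
    (hZ : Smooth Ω Z) (hN : Normed Z) {β : W₁ →L[ℝ] W₂ →L[ℝ] W₃} (h : BilinCompat Ω X Y Z β)
    {s : V → W₁} {t : V → W₂} (hs : ContDiffOn ℝ ∞ s Ω) (ht : ContDiffOn ℝ ∞ t Ω) {a b : ℝ≥0∞}
    (ha : ∀ j ≤ i, normCov Ω T y₀ j X s ≤ a) (hb : ∀ j ≤ i, normCov Ω T y₀ j Y t ≤ b) :
    normCov Ω T y₀ i Z (fun y => β (s y) (t y)) ≤ 2 ^ i * (a * b) := by
  induction i generalizing W₁ W₂ W₃ with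
  | zero =>
    simp only [pow_zero, one_mul]
    exact (h.norm_le _ _).trans (mul_le_mul' (ha 0 le_rfl) (hb 0 le_rfl))
  | succ i ih =>
    simp only [normCov]
    rw [normCov_congr hy₀ i _ (covD_bilin hΩ h hs ht)]
    have hs' := contDiffOn_covD hΩ hX hs
    have ht' := contDiffOn_covD hΩ hY ht
    refine (normCov_add_le hΩ hy₀ hT i (hT.hom hZ) (Normed.hom T hN)
      (contDiffOn_bilin _ hs' ht) (contDiffOn_bilin _ hs ht')).trans ?_
    have h1 := ih (hT.hom hX) hY (hT.hom hZ) (Normed.hom T hN) (h.liftLeft T) hs' ht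
      (fun j hj => ha (j + 1) (by omega)) (fun j hj => hb j (by omega))
    have h2 := ih hX (hT.hom hY) (hT.hom hZ) (Normed.hom T hN) (h.liftRight T) hs ht'
      (fun j hj => ha j (by omega)) (fun j hj => hb (j + 1) (by omega))
    calc _ ≤ 2 ^ i * (a * b) + 2 ^ i * (a * b) := add_le_add h1 h2
      _ = _ := by ring

/-- The composition of homomorphisms is parallel and has norm at most one. -/
lemma bilinCompat_comp {X : Conn V W₁} (hX : Definite X) {Y : Conn V W₂} (hY : Normed Y)
    (Q : Conn V U) :
    BilinCompat Ω (hom X Y) (hom Q X) (hom Q Y) (ContinuousLinearMap.compL ℝ U W₁ W₂) where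
  parallel y hy x f k := by
    ext u
    simp
  norm_le f k := by
    refine iSup₂_le fun u hu => (le_hom_mul hX hY f (k u)).trans ?_
    gcongr
    exact le_iSup₂ (f := fun u (_ : Q.N u ≤ 1) => X.N (k u)) u hu

lemma bilinCompat_lsmul {X : Conn V W} (hX : Normed X) :
    BilinCompat Ω (triv V) X X (ContinuousLinearMap.lsmul ℝ ℝ : ℝ →L[ℝ] W →L[ℝ] W) where
  parallel y hy x a b := by simp
  norm_le a b := (hX.smul a b).le

/-- A parallel linear bundle map that is isometric at `y₀`. -/
structure IsometryCompat (Ω : Set V) (y₀ : V) (X : Conn V W₁) (Y : Conn V W₂)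
    (L : V → W₁ →L[ℝ] W₂) : Prop where
  smooth : ContDiffOn ℝ ∞ L Ω
  parallel : ∀ y ∈ Ω, ∀ x w, fderivWithin ℝ L Ω y x w + Y.A y x (L y w) = L y (X.A y x w)
  norm_eq : ∀ w, Y.N (L y₀ w) = X.N w

/-- Postcomposition with a linear bundle map. -/
def liftMap (U : Type) [NormedAddCommGroup U] [NormedSpace ℝ U] (L : V → W₁ →L[ℝ] W₂) (y : V) :
    (U →L[ℝ] W₁) →L[ℝ] (U →L[ℝ] W₂) := ContinuousLinearMap.compL ℝ U W₁ W₂ (L y)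

@[simp] lemma liftMap_apply (L : V → W₁ →L[ℝ] W₂) (y : V) (f : U →L[ℝ] W₁) (u : U) :
    liftMap U L y f u = L y (f u) := rfl

lemma IsometryCompat.lift (hΩ : UniqueDiffOn ℝ Ω) {X : Conn V W₁} {Y : Conn V W₂}
    {L : V → W₁ →L[ℝ] W₂} (h : IsometryCompat Ω y₀ X Y L) (Q : Conn V U) :
    IsometryCompat Ω y₀ (hom Q X) (hom Q Y) (liftMap U L) where
  smooth := (ContinuousLinearMap.compL ℝ U W₁ W₂).contDiff.comp_contDiffOn h.smooth
  parallel y hy x f := by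
    have h1 := ((ContinuousLinearMap.compL ℝ U W₁ W₂).hasFDerivAt.comp_hasFDerivWithinAt y
      (h.smooth.differentiableOn (by simp) y hy).hasFDerivWithinAt).fderivWithin (hΩ y hy)
    have h2 : fderivWithin ℝ (liftMap U L) Ω y = _ := h1
    ext u
    have h3 := h.parallel y hy x (f u)
    simp only [h2, add_apply, hom_A_apply, liftMap_apply, map_sub, ← h3,
      ContinuousLinearMap.comp_apply, ContinuousLinearMap.compL_apply]
    abel
  norm_eq f := by
    change (⨆ (u : U) (_ : Q.N u ≤ 1), Y.N (L y₀ (f u))) = _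
    simp only [h.norm_eq]
    rfl

lemma IsometryCompat.covD_eq (hΩ : UniqueDiffOn ℝ Ω) {X : Conn V W₁} {Y : Conn V W₂}
    {L : V → W₁ →L[ℝ] W₂} (h : IsometryCompat Ω y₀ X Y L) {s : V → W₁}
    (hs : ContDiffOn ℝ ∞ s Ω) :
    EqOn (covD Ω Y (fun y => L y (s y))) (fun y => liftMap V L y (covD Ω X s y)) Ω := by
  intro y hy
  have h1 := ((h.smooth.differentiableOn (by simp) y hy).hasFDerivWithinAt.clm_apply
    (hs.differentiableOn (by simp) y hy).hasFDerivWithinAt).fderivWithin (hΩ y hy)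
  ext x
  have h3 := h.parallel y hy x (s y)
  simp only [covD_apply, h1, add_apply, liftMap_apply, map_add, ← h3,
    ContinuousLinearMap.comp_apply, ContinuousLinearMap.flip_apply]
  abel

/-- A parallel map commutes with covariant differentiation, so after all derivatives are taken only
its isometry property at the single point `y₀` matters. -/
lemma IsometryCompat.normCov_eq (hΩ : UniqueDiffOn ℝ Ω) (hy₀ : y₀ ∈ Ω) (i : ℕ) {X : Conn V W₁}
    {Y : Conn V W₂} (hX : Smooth Ω X)
    {L : V → W₁ →L[ℝ] W₂} (h : IsometryCompat Ω y₀ X Y L) (hT : Smooth Ω T) {s : V → W₁}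
    (hs : ContDiffOn ℝ ∞ s Ω) :
    normCov Ω T y₀ i Y (fun y => L y (s y)) = normCov Ω T y₀ i X s := by
  induction i generalizing W₁ W₂ with
  | zero => exact h.norm_eq _
  | succ i ih =>
    simp only [normCov]
    rw [normCov_congr hy₀ i _ (h.covD_eq hΩ hs)]
    exact ih (hT.hom hX) (h.lift hΩ T) (contDiffOn_covD hΩ hX hs)

lemma isometryCompat_neg {X : Conn V W} (hX : Normed X) :
    IsometryCompat Ω y₀ X X (fun _ => -ContinuousLinearMap.id ℝ W) where
  smooth := contDiffOn_const
  parallel y hy x w := by simp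
  norm_eq w := by
    have := hX.smul (-1) w
    simpa using this

/-- Exchanging two arguments exchanges two suprema. This serves to antisymmetrize the derivative of
the second fundamental form. -/
lemma isometryCompat_flip (Q : Conn V U) (X : Conn V W) :
    IsometryCompat Ω y₀ (hom Q (hom Q X)) (hom Q (hom Q X))
      (fun _ => ((ContinuousLinearMap.flipₗᵢ ℝ U U W).toContinuousLinearEquiv :
        (U →L[ℝ] U →L[ℝ] W) →L[ℝ] (U →L[ℝ] U →L[ℝ] W))) where
  smooth := contDiffOn_const
  parallel y hy x w := by
    ext u v
    simp [sub_right_comm]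
  norm_eq w := by
    change (⨆ (u : U) (_ : Q.N u ≤ 1), ⨆ (v : U) (_ : Q.N v ≤ 1), X.N (w v u)) =
      ⨆ (u : U) (_ : Q.N u ≤ 1), ⨆ (v : U) (_ : Q.N v ≤ 1), X.N (w u v)
    exact iSup₂_comm _

lemma normCov_sub_le (hΩ : UniqueDiffOn ℝ Ω) (hy₀ : y₀ ∈ Ω) (hT : Smooth Ω T) (i : ℕ)
    {X : Conn V W} (hX : Smooth Ω X) (hN : Normed X) {s t : V → W} (hs : ContDiffOn ℝ ∞ s Ω)
    (ht : ContDiffOn ℝ ∞ t Ω) :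
    normCov Ω T y₀ i X (fun y => s y - t y) ≤ normCov Ω T y₀ i X s + normCov Ω T y₀ i X t := by
  have h1 := (isometryCompat_neg (Ω := Ω) (y₀ := y₀) hN).normCov_eq hΩ hy₀ i hX hT ht
  rw [← h1]
  simpa [sub_eq_add_neg] using normCov_add_le hΩ hy₀ hT i hX hN hs ht.neg

end Bounds

end Conn

/-! ### Inner products as bilinear forms -/

section Forms
variable {V : Type} [NormedAddCommGroup V] [NormedSpace ℝ V]

/-- The form `B` is an inner product. -/
structure IsInner (B : V →L[ℝ] V →L[ℝ] ℝ) : Prop where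
  symm : ∀ v w, B v w = B w v
  pos : ∀ v, v ≠ 0 → 0 < B v v

variable {B : V →L[ℝ] V →L[ℝ] ℝ}

lemma IsInner.nonneg (h : IsInner B) (v : V) : 0 ≤ B v v := by
  rcases eq_or_ne v 0 with rfl | hv
  · simp
  · exact (h.pos v hv).le

lemma IsInner.eq_of_forall (h : IsInner B) {v w : V} (hvw : ∀ z, B v z = B w z) : v = w := by
  by_contra hne
  have h1 : B (v - w) (v - w) = 0 := by rw [map_sub B v w, sub_apply, hvw, sub_self]
  exact (h.pos (v - w) (sub_ne_zero.2 hne)).ne' h1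

lemma IsInner.cauchySchwarz (h : IsInner B) (v w : V) : (B v w) ^ 2 ≤ B v v * B w w := by
  rcases eq_or_ne w 0 with rfl | hw
  · simp
  · have hpos := h.pos w hw
    have h1 := h.nonneg (B w w • v - B v w • w)
    simp only [map_sub, map_smul, sub_apply, smul_apply, smul_eq_mul, h.symm w v] at h1
    have h2 : 0 ≤ B w w * (B v v * B w w - (B v w) ^ 2) := by nlinarith
    linarith [nonneg_of_mul_nonneg_right h2 hpos]

lemma IsInner.abs_le (h : IsInner B) (v w : V) : |B v w| ≤ √(B v v) * √(B w w) := by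
  rw [← Real.sqrt_mul (h.nonneg v), ← Real.sqrt_sq_eq_abs]
  exact Real.sqrt_le_sqrt (h.cauchySchwarz v w)

/-- The length of a vector. -/
def vecNorm (B : V →L[ℝ] V →L[ℝ] ℝ) (v : V) : ℝ≥0∞ := ENNReal.ofReal √(B v v)

lemma vecNorm_le_one {v : V} : vecNorm B v ≤ 1 ↔ B v v ≤ 1 := by
  rw [vecNorm, ENNReal.ofReal_le_one, Real.sqrt_le_iff]
  simp

/-- Cauchy–Schwarz in one direction, the normalized vector `v` as a test vector in the other. This
is why lowering an index is isometric. -/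
lemma IsInner.dual_norm (h : IsInner B) (v : V) :
    (⨆ (w : V) (_ : vecNorm B w ≤ 1), ENNReal.ofReal |B v w|) = vecNorm B v := by
  apply le_antisymm
  · refine iSup₂_le fun w hw => ENNReal.ofReal_le_ofReal ((h.abs_le v w).trans ?_)
    have : √(B w w) ≤ 1 := by simpa [vecNorm, ENNReal.ofReal_le_one] using hw
    exact mul_le_of_le_one_right (Real.sqrt_nonneg _) this
  · rcases eq_or_ne v 0 with rfl | hv
    · simp [vecNorm]
    · have hs : 0 < √(B v v) := Real.sqrt_pos.2 (h.pos v hv)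
      have hsq : √(B v v) * √(B v v) = B v v := Real.mul_self_sqrt (h.nonneg v)
      refine le_iSup₂_of_le ((√(B v v))⁻¹ • v) ?_ ?_
      · rw [vecNorm_le_one]
        simp only [map_smul, smul_apply, smul_eq_mul]
        rw [← hsq]
        field_simp
        simp
      · refine ENNReal.ofReal_le_ofReal ((le_abs_self _).trans' ?_)
        simp only [map_smul, smul_eq_mul]
        nth_rw 3 [← hsq]
        field_simp
        exact le_rfl

end Forms

/-! ### The Levi-Civita connection in coordinates -/

section LeviCivita

lemma fderivWithin_apply_const {V W W' : Type} [NormedAddCommGroup V] [NormedSpace ℝ V]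
    [NormedAddCommGroup W] [NormedSpace ℝ W] [NormedAddCommGroup W'] [NormedSpace ℝ W']
    {Ω : Set V} (hΩ : UniqueDiffOn ℝ Ω) {f : V → W →L[ℝ] W'} {y : V} (hy : y ∈ Ω)
    (hf : DifferentiableWithinAt ℝ f Ω y) (u : V) (w : W) :
    fderivWithin ℝ (fun z => f z w) Ω y u = fderivWithin ℝ f Ω y u w := by
  have := (hf.hasFDerivWithinAt.clm_apply (hasFDerivWithinAt_const w y Ω)).fderivWithin (hΩ y hy)
  rw [this]
  simp

lemma fderivWithin_apply_const₂ {V W₁ W₂ W' : Type} [NormedAddCommGroup V] [NormedSpace ℝ V]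
    [NormedAddCommGroup W₁] [NormedSpace ℝ W₁] [NormedAddCommGroup W₂] [NormedSpace ℝ W₂]
    [NormedAddCommGroup W'] [NormedSpace ℝ W']
    {Ω : Set V} (hΩ : UniqueDiffOn ℝ Ω) {f : V → W₁ →L[ℝ] W₂ →L[ℝ] W'} {y : V} (hy : y ∈ Ω)
    (hf : DifferentiableWithinAt ℝ f Ω y) (u : V) (v : W₁) (w : W₂) :
    fderivWithin ℝ (fun z => f z v w) Ω y u = fderivWithin ℝ f Ω y u v w := by
  rw [fderivWithin_apply_const hΩ hy (f := fun z => f z v)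
    (hf.clm_apply (differentiableWithinAt_const v)), fderivWithin_apply_const hΩ hy hf]

variable {V : Type} [NormedAddCommGroup V] [NormedSpace ℝ V] [FiniteDimensional ℝ V]

/-- `G` is a smooth Riemannian metric on `Ω`. -/
structure IsMetricOn (Ω : Set V) (G : V → V →L[ℝ] V →L[ℝ] ℝ) : Prop where
  uniqueDiffOn : UniqueDiffOn ℝ Ω
  smooth : ContDiffOn ℝ ∞ G Ω
  inner : ∀ y ∈ Ω, IsInner (G y)

/-- The bilinear map of the Christoffel symbols. -/
def christoffelL (Ω : Set V) (G : V → V →L[ℝ] V →L[ℝ] ℝ) (y : V) : V →L[ℝ] V →L[ℝ] V :=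
  (ContinuousLinearMap.compL ℝ V (V →L[ℝ] ℝ) V (G y).inverse).comp
    ((1 / 2 : ℝ) • (fderivWithin ℝ G Ω y + (fderivWithin ℝ G Ω y).flip -
      ((ContinuousLinearMap.flipₗᵢ ℝ V V ℝ).toContinuousLinearEquiv :
        (V →L[ℝ] V →L[ℝ] ℝ) →L[ℝ] (V →L[ℝ] V →L[ℝ] ℝ)).comp (fderivWithin ℝ G Ω y).flip))

lemma christoffelL_apply (Ω : Set V) (G : V → V →L[ℝ] V →L[ℝ] ℝ) (y u v : V) :
    christoffelL Ω G y u v = christoffel Ω G y u v := rfl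

variable {Ω : Set V} {G : V → V →L[ℝ] V →L[ℝ] ℝ}

lemma IsInner.exists_equiv {B : V →L[ℝ] V →L[ℝ] ℝ} (h : IsInner B) :
    ∃ e : V ≃L[ℝ] (V →L[ℝ] ℝ), (e : V →L[ℝ] V →L[ℝ] ℝ) = B := by
  have hinj : Injective B := fun v w hvw => h.eq_of_forall fun z => by rw [hvw]
  have hdim : Module.finrank ℝ V = Module.finrank ℝ (V →L[ℝ] ℝ) :=
    Subspace.dual_finrank_eq.symm.trans
      (LinearMap.toContinuousLinearMap : (V →ₗ[ℝ] ℝ) ≃ₗ[ℝ] V →L[ℝ] ℝ).finrank_eq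
  exact ⟨(LinearEquiv.ofInjectiveOfFinrankEq (B : V →ₗ[ℝ] V →L[ℝ] ℝ) hinj
    hdim).toContinuousLinearEquiv, by ext; rfl⟩

lemma IsMetricOn.contDiffOn_inverse (h : IsMetricOn Ω G) :
    ContDiffOn ℝ ∞ (fun y => (G y).inverse) Ω := by
  intro y hy
  obtain ⟨e, he⟩ := (h.inner y hy).exists_equiv
  have : CompleteSpace V := FiniteDimensional.complete ℝ V
  have h1 : ContDiffAt ℝ ∞ (ContinuousLinearMap.inverse : (V →L[ℝ] V →L[ℝ] ℝ) → _) (G y) := by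
    rw [← he]
    exact contDiffAt_map_inverse e
  exact h1.comp_contDiffWithinAt y (h.smooth y hy)

lemma IsMetricOn.contDiffOn_fderiv (h : IsMetricOn Ω G) :
    ContDiffOn ℝ ∞ (fderivWithin ℝ G Ω) Ω := h.smooth.fderivWithin h.uniqueDiffOn (by simp)

lemma IsMetricOn.contDiffOn_christoffelL (h : IsMetricOn Ω G) :
    ContDiffOn ℝ ∞ (christoffelL Ω G) Ω := by
  have h1 := h.contDiffOn_fderiv
  have h2 := Conn.contDiffOn_flip h1
  have h3 : ContDiffOn ℝ ∞ (fun y => ContinuousLinearMap.compL ℝ V (V →L[ℝ] ℝ) V (G y).inverse) Ω :=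
    (ContinuousLinearMap.compL ℝ V (V →L[ℝ] ℝ) V).contDiff.comp_contDiffOn h.contDiffOn_inverse
  exact h3.clm_comp (((h1.add h2).sub (contDiffOn_const.clm_comp h2)).const_smul _)

lemma IsMetricOn.fderiv_symm (h : IsMetricOn Ω G) {y : V} (hy : y ∈ Ω) (u v w : V) :
    fderivWithin ℝ G Ω y u v w = fderivWithin ℝ G Ω y u w v := by
  have hd := h.smooth.differentiableOn (by simp) y hy
  rw [← fderivWithin_apply_const₂ h.uniqueDiffOn hy hd, ← fderivWithin_apply_const₂ h.uniqueDiffOn hy hd]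
  rw [fderivWithin_congr (fun z hz => (h.inner z hz).symm v w) ((h.inner y hy).symm v w)]

lemma IsMetricOn.koszul (h : IsMetricOn Ω G) {y : V} (hy : y ∈ Ω) (u v w : V) :
    G y (christoffelL Ω G y u v) w = (1 / 2 : ℝ) * (fderivWithin ℝ G Ω y u v w
      + fderivWithin ℝ G Ω y v u w - fderivWithin ℝ G Ω y w u v) := by
  rw [christoffelL_apply, christoffel, apply_inverse_of_pos (G y) (h.inner y hy).pos]
  simp

/-- Torsion-freeness: the Koszul expression is symmetric in `u` and `v`, since derivatives of `G`
are symmetric forms. -/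
lemma IsMetricOn.christoffelL_comm (h : IsMetricOn Ω G) {y : V} (hy : y ∈ Ω) (u v : V) :
    christoffelL Ω G y u v = christoffelL Ω G y v u := by
  refine (h.inner y hy).eq_of_forall fun w => ?_
  rw [h.koszul hy, h.koszul hy, h.fderiv_symm hy w u v]
  ring

/-- Metric compatibility: in the sum of the two Koszul expressions everything but the derivative
along `x` cancels. -/
lemma IsMetricOn.compat (h : IsMetricOn Ω G) {y : V} (hy : y ∈ Ω) (x v w : V) :
    fderivWithin ℝ G Ω y x v w =
      G y (christoffelL Ω G y x v) w + G y v (christoffelL Ω G y x w) := by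
  rw [(h.inner y hy).symm v, h.koszul hy, h.koszul hy, h.fderiv_symm hy x w v,
    h.fderiv_symm hy v x w, h.fderiv_symm hy w x v]
  ring

open Conn

/-- The tangent bundle of the coordinate domain with the Levi-Civita connection, and with the norm
at `y₀`. -/
def tangent (Ω : Set V) (G : V → V →L[ℝ] V →L[ℝ] ℝ) (y₀ : V) : Conn V V where
  A := christoffelL Ω G
  N := vecNorm (G y₀)

lemma IsInner.definite {V' : Type} [NormedAddCommGroup V'] [NormedSpace ℝ V'] {X : Conn V' V}
    {B : V →L[ℝ] V →L[ℝ] ℝ} (hB : IsInner B) (hX : X.N = vecNorm B) : Definite X where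
  add_le a b := by
    rw [hX, vecNorm, vecNorm, vecNorm, ← ENNReal.ofReal_add (Real.sqrt_nonneg _) (Real.sqrt_nonneg _)]
    refine ENNReal.ofReal_le_ofReal ?_
    rw [Real.sqrt_le_left (by positivity)]
    have h1 := (le_abs_self _).trans (hB.abs_le a b)
    have h2 := Real.sq_sqrt (hB.nonneg a)
    have h3 := Real.sq_sqrt (hB.nonneg b)
    simp only [map_add, add_apply, hB.symm b a]
    nlinarith
  smul c a := by
    rw [hX, vecNorm, vecNorm, ← ENNReal.ofReal_mul (abs_nonneg c)]
    congr 1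
    simp only [map_smul, smul_apply, smul_eq_mul]
    rw [← mul_assoc, Real.sqrt_mul (mul_self_nonneg c), Real.sqrt_mul_self_eq_abs]
  ne_top a := by rw [hX]; exact ENNReal.ofReal_ne_top
  ne_zero a ha := by
    rw [hX, vecNorm, ne_eq, ENNReal.ofReal_eq_zero, not_le]
    exact Real.sqrt_pos.2 (hB.pos a ha)

variable {y₀ : V}

lemma IsMetricOn.definite (h : IsMetricOn Ω G) (hy₀ : y₀ ∈ Ω) : Definite (tangent Ω G y₀) :=
  (h.inner y₀ hy₀).definite rfl

lemma IsMetricOn.smooth_tangent (h : IsMetricOn Ω G) : Smooth Ω (tangent Ω G y₀) :=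
  h.contDiffOn_christoffelL

/-- Lowering an index is parallel and isometric. -/
lemma IsMetricOn.isometryCompat (h : IsMetricOn Ω G) (hy₀ : y₀ ∈ Ω) :
    IsometryCompat Ω y₀ (tangent Ω G y₀) (hom (tangent Ω G y₀) (triv V)) G where
  smooth := h.smooth
  parallel y hy x w := by
    ext z
    rw [add_apply, hom_A_apply, h.compat hy]
    simp [tangent]
  norm_eq w := (h.inner y₀ hy₀).dual_norm w

/-- The curvature as a trilinear map. -/
def curvatureL (Ω : Set V) (G : V → V →L[ℝ] V →L[ℝ] ℝ) (y : V) : V →L[ℝ] V →L[ℝ] V →L[ℝ] V :=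
  let Q := fderivWithin ℝ (christoffelL Ω G) Ω y +
    ((ContinuousLinearMap.compL ℝ V (V →L[ℝ] V) (V →L[ℝ] V)).flip (christoffelL Ω G y)).comp
      ((ContinuousLinearMap.compL ℝ V V V).comp (christoffelL Ω G y))
  Q - Q.flip

lemma curvatureL_apply' (y u v w : V) : curvatureL Ω G y u v w =
    (fderivWithin ℝ (christoffelL Ω G) Ω y u v w
      + christoffelL Ω G y u (christoffelL Ω G y v w))
    - (fderivWithin ℝ (christoffelL Ω G) Ω y v u w
      + christoffelL Ω G y v (christoffelL Ω G y u w)) := rfl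

lemma IsMetricOn.curvatureL_apply (h : IsMetricOn Ω G) {y : V} (hy : y ∈ Ω) (u v w : V) :
    curvatureL Ω G y u v w = curvature Ω G y u v w := by
  have hd := h.contDiffOn_christoffelL.differentiableOn (by simp) y hy
  simp only [curvature, ← christoffelL_apply]
  rw [fderivWithin_apply_const₂ h.uniqueDiffOn hy hd, fderivWithin_apply_const₂ h.uniqueDiffOn hy hd,
    curvatureL_apply']
  abel

lemma IsMetricOn.contDiffOn_curvatureL (h : IsMetricOn Ω G) :
    ContDiffOn ℝ ∞ (curvatureL Ω G) Ω := by
  have h0 := h.contDiffOn_christoffelL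
  have h1 : ContDiffOn ℝ ∞ (fderivWithin ℝ (christoffelL Ω G) Ω) Ω :=
    h0.fderivWithin h.uniqueDiffOn (by simp)
  have h2 : ContDiffOn ℝ ∞ (fun y => (ContinuousLinearMap.compL ℝ V (V →L[ℝ] V) (V →L[ℝ] V)).flip
      (christoffelL Ω G y)) Ω :=
    (ContinuousLinearMap.compL ℝ V (V →L[ℝ] V) (V →L[ℝ] V)).flip.contDiff.comp_contDiffOn h0
  have h3 := h1.add (h2.clm_comp
    (contDiffOn_const (c := ContinuousLinearMap.compL ℝ V V V) |>.clm_comp h0))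
  exact h3.sub (contDiffOn_flip h3)

end LeviCivita

/-! ### Iterated covariant derivatives of covariant tensors -/

section Eval
open Conn

lemma tensorNorm_cast {V : Type} [NormedAddCommGroup V] [NormedSpace ℝ V]
    (B : V →L[ℝ] V →L[ℝ] ℝ) {k k' : ℕ} (h : k = k') (T : (Fin k → V) → ℝ) :
    tensorNorm B (fun v : Fin k' → V => T (v ∘ Fin.cast h)) = tensorNorm B T := by
  subst h; rfl

/-- Peels off the innermost derivative instead of the outermost, to match the recursion of
`normCov`. The cast reconciles `k + 1 + i` with `k + (i + 1)`. -/
lemma iterCovDeriv_succ' {V : Type} [NormedAddCommGroup V] [NormedSpace ℝ V] (S : Set V)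
    (G : V → V →L[ℝ] V →L[ℝ] ℝ) {k : ℕ} (T : V → (Fin k → V) → ℝ) (i : ℕ) :
    iterCovDeriv S G T (i + 1) = fun y v => iterCovDeriv S G (covDeriv S G T) i y
      (v ∘ Fin.cast (Nat.succ_add_eq_add_succ k i)) := by
  have key : ∀ {a b : ℕ} (h : a = b) (U : V → (Fin a → V) → ℝ),
      covDeriv S G (fun y (v : Fin b → V) => U y (v ∘ Fin.cast h)) =
        fun y v => covDeriv S G U y (v ∘ Fin.cast (congrArg (· + 1) h)) := by
    intro a b h U
    subst h; rfl
  induction i with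
  | zero => rfl
  | succ i ih =>
    rw [iterCovDeriv, ih]
    exact key (Nat.succ_add_eq_add_succ k i) (iterCovDeriv S G (covDeriv S G T) i)

/-- Derivatives within two sets that agree near each point coincide. This replaces the range of the
model, used in the definitions, by the chart target, where the metric is smooth. -/
lemma iterCovDeriv_congr {V : Type} [NormedAddCommGroup V] [NormedSpace ℝ V] {S Ω : Set V}
    (hS : ∀ y ∈ Ω, S =ᶠ[nhds y] Ω) {G G' : V → V →L[ℝ] V →L[ℝ] ℝ} (hG : EqOn G G' Ω) {k : ℕ}
    {T T' : V → (Fin k → V) → ℝ} (hT : EqOn T T' Ω) (i : ℕ) :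
    EqOn (iterCovDeriv S G T i) (iterCovDeriv Ω G' T' i) Ω := by
  induction i with
  | zero => exact hT
  | succ i ih =>
    intro y hy
    ext v
    simp only [iterCovDeriv, covDeriv, christoffel]
    rw [ih hy, fderivWithin_congr_set (hS y hy), fderivWithin_congr_set (hS y hy),
      fderivWithin_congr hG (hG hy), hG hy, fderivWithin_congr (fun z hz => by rw [ih hz])
      (by rw [ih hy])]

lemma curvatureTensor_congr {V : Type} [NormedAddCommGroup V] [NormedSpace ℝ V] {S Ω : Set V}
    (hS : ∀ y ∈ Ω, S =ᶠ[nhds y] Ω) {G G' : V → V →L[ℝ] V →L[ℝ] ℝ} (hG : EqOn G G' Ω) :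
    EqOn (curvatureTensor S G) (curvatureTensor Ω G') Ω := by
  have h1 : ∀ u v, EqOn (fun z => christoffel S G z u v) (fun z => christoffel Ω G' z u v) Ω := by
    intro u v y hy
    simp only [christoffel]
    rw [fderivWithin_congr_set (hS y hy), fderivWithin_congr hG (hG hy), hG hy]
  intro y hy
  ext v
  have h2 := fun u v => h1 u v hy
  simp only at h2
  simp only [curvatureTensor, curvature]
  rw [fderivWithin_congr_set (hS y hy), fderivWithin_congr_set (hS y hy),
    fderivWithin_congr (h1 _ _) (h1 _ _ hy), fderivWithin_congr (h1 _ _) (h1 _ _ hy), hG hy]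
  simp only [h2]

variable {V W : Type} [NormedAddCommGroup V] [NormedSpace ℝ V] [FiniteDimensional ℝ V]
  [NormedAddCommGroup W] [NormedSpace ℝ W]

/-- The bundle `X` consists of covariant `k`-tensors, by means of the evaluation `ev`. -/
structure IsEval (Ω : Set V) (G : V → V →L[ℝ] V →L[ℝ] ℝ) (y₀ : V) {k : ℕ} (X : Conn V W)
    (ev : (Fin k → V) → W →L[ℝ] ℝ) : Prop where
  compat : ∀ y ∈ Ω, ∀ x v w,
    ev v (X.A y x w) = -∑ i, ev (update v i (christoffel Ω G y x (v i))) w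
  norm_eq : ∀ w, X.N w = tensorNorm (G y₀) (fun v => ev v w)

variable {Ω : Set V} {G : V → V →L[ℝ] V →L[ℝ] ℝ} {y₀ : V}

lemma isEval_triv : IsEval Ω G y₀ (triv V) (fun _ : Fin 0 → V => ContinuousLinearMap.id ℝ ℝ) where
  compat y hy x v w := by simp
  norm_eq w := by
    simp only [tensorNorm, IsEmpty.forall_iff, iSup_pos, ContinuousLinearMap.id_apply, iSup_const]
    rfl

/-- Evaluation with the outermost argument in the first slot. -/
def evCons {k : ℕ} (ev : (Fin k → V) → W →L[ℝ] ℝ) (v : Fin (k + 1) → V) : (V →L[ℝ] W) →L[ℝ] ℝ :=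
  (ev (Fin.tail v)).comp (ContinuousLinearMap.apply ℝ W (v 0))

/-- Evaluation with the outermost argument in the last slot. -/
def evSnoc {k : ℕ} (ev : (Fin k → V) → W →L[ℝ] ℝ) (v : Fin (k + 1) → V) : (V →L[ℝ] W) →L[ℝ] ℝ :=
  (ev (Fin.init v)).comp (ContinuousLinearMap.apply ℝ W (v (Fin.last k)))

lemma evCons_apply {k : ℕ} (ev : (Fin k → V) → W →L[ℝ] ℝ) (v : Fin (k + 1) → V) (f : V →L[ℝ] W) :
    evCons ev v f = ev (Fin.tail v) (f (v 0)) := rfl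

lemma evSnoc_apply {k : ℕ} (ev : (Fin k → V) → W →L[ℝ] ℝ) (v : Fin (k + 1) → V) (f : V →L[ℝ] W) :
    evSnoc ev v f = ev (Fin.init v) (f (v (Fin.last k))) := rfl

/-- Serves to write a multilinear map as a covariant tensor, its outermost argument being the first
one. The counterpart `IsEval.snoc` serves for derivatives, whose new slot is the last one. -/
lemma IsEval.cons {k : ℕ} {X : Conn V W} {ev : (Fin k → V) → W →L[ℝ] ℝ}
    (h : IsEval Ω G y₀ X ev) : IsEval Ω G y₀ (hom (tangent Ω G y₀) X) (evCons ev) where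
  compat y hy x v f := by
    simp only [evCons_apply, hom_A_apply, map_sub, h.compat y hy, Fin.sum_univ_succ,
      Fin.tail_update_zero, Fin.tail_update_succ, update_self, Fin.tail]
    simp only [update_of_ne (Fin.succ_ne_zero _).symm, tangent, christoffelL_apply]
    ring
  norm_eq f := by
    change (⨆ (u : V) (_ : vecNorm (G y₀) u ≤ 1), X.N (f u)) = _
    simp only [h.norm_eq, tensorNorm, evCons_apply]
    apply le_antisymm
    · refine iSup₂_le fun u hu => iSup₂_le fun v hv => ?_
      refine le_iSup₂_of_le (Fin.cons u v : Fin (k + 1) → V) ?_ ?_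
      · intro i
        refine Fin.cases ?_ (fun j => ?_) i
        · simpa using vecNorm_le_one.1 hu
        · simpa using hv j
      · simp
    · refine iSup₂_le fun v hv => ?_
      refine le_iSup₂_of_le (v 0) (vecNorm_le_one.2 (hv 0)) ?_
      exact le_iSup₂_of_le (Fin.tail v) (fun i => hv i.succ) le_rfl

lemma IsEval.snoc {k : ℕ} {X : Conn V W} {ev : (Fin k → V) → W →L[ℝ] ℝ}
    (h : IsEval Ω G y₀ X ev) : IsEval Ω G y₀ (hom (tangent Ω G y₀) X) (evSnoc ev) where
  compat y hy x v f := by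
    simp only [evSnoc_apply, hom_A_apply, map_sub, h.compat y hy, Fin.sum_univ_castSucc,
      Fin.init_update_last, Fin.init_update_castSucc, update_self]
    simp only [update_of_ne (Fin.castSucc_ne_last _).symm, tangent, christoffelL_apply, Fin.init]
    ring
  norm_eq f := by
    change (⨆ (u : V) (_ : vecNorm (G y₀) u ≤ 1), X.N (f u)) = _
    simp only [h.norm_eq, tensorNorm, evSnoc_apply]
    apply le_antisymm
    · refine iSup₂_le fun u hu => iSup₂_le fun v hv => ?_
      refine le_iSup₂_of_le (Fin.snoc v u : Fin (k + 1) → V) ?_ ?_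
      · intro i
        refine Fin.lastCases ?_ (fun j => ?_) i
        · simpa using vecNorm_le_one.1 hu
        · simpa using hv j
      · simp
    · refine iSup₂_le fun v hv => ?_
      refine le_iSup₂_of_le (v (Fin.last k)) (vecNorm_le_one.2 (hv _)) ?_
      exact le_iSup₂_of_le (Fin.init v) (fun i => hv i.castSucc) le_rfl

/-- Evaluation on constant vectors commutes with differentiation, and the Christoffel corrections in
`covDeriv` are exactly those of `IsEval.compat`. -/
lemma IsEval.normCov_eq (hG : IsMetricOn Ω G) (hy₀ : y₀ ∈ Ω) (i : ℕ) {k : ℕ} {X : Conn V W}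
    (hX : Smooth Ω X) {ev : (Fin k → V) → W →L[ℝ] ℝ} (h : IsEval Ω G y₀ X ev) {s : V → W}
    (hs : ContDiffOn ℝ ∞ s Ω) {T : V → (Fin k → V) → ℝ} (hT : ∀ y ∈ Ω, ∀ v, T y v = ev v (s y)) :
    normCov Ω (tangent Ω G y₀) y₀ i X s = tensorNorm (G y₀) (iterCovDeriv Ω G T i y₀) := by
  induction i generalizing W k with
  | zero =>
    simp only [normCov, h.norm_eq, iterCovDeriv]
    congr 1
    ext v
    exact (hT y₀ hy₀ v).symm
  | succ i ih =>
    rw [iterCovDeriv_succ']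
    simp only [normCov]
    rw [tensorNorm_cast (G y₀) (Nat.succ_add_eq_add_succ k i)
      (iterCovDeriv Ω G (covDeriv Ω G T) i y₀)]
    refine ih (hG.smooth_tangent.hom hX) h.snoc (contDiffOn_covD hG.uniqueDiffOn hX hs) ?_
    intro y hy v
    have hd := (hs.differentiableOn (by simp) y hy).hasFDerivWithinAt
    have h1 := ((ev (Fin.init v)).hasFDerivAt.comp_hasFDerivWithinAt y hd).fderivWithin
      (hG.uniqueDiffOn y hy)
    rw [evSnoc_apply, covD_apply, map_add, h.compat y hy, covDeriv,
      fderivWithin_congr (fun z hz => hT z hz _) (hT y hy _)]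
    simp only [hT y hy]
    change fderivWithin ℝ (ev (Fin.init v) ∘ s) Ω y _ - _ = _
    rw [h1, sub_eq_add_neg]
    rfl

/-- The fully covariant curvature tensor and the vector valued one have the same norms. -/
lemma IsMetricOn.normCov_curvatureL (hG : IsMetricOn Ω G) (hy₀ : y₀ ∈ Ω) (i : ℕ) :
    normCov Ω (tangent Ω G y₀) y₀ i (hom (tangent Ω G y₀) (hom (tangent Ω G y₀)
      (hom (tangent Ω G y₀) (tangent Ω G y₀)))) (curvatureL Ω G) =
    tensorNorm (G y₀) (iterCovDeriv Ω G (curvatureTensor Ω G) i y₀) := by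
  have hT : Smooth Ω (tangent Ω G y₀) := hG.smooth_tangent
  have hR := hG.contDiffOn_curvatureL
  have hL := (((hG.isometryCompat hy₀).lift hG.uniqueDiffOn (tangent Ω G y₀)).lift hG.uniqueDiffOn
    (tangent Ω G y₀)).lift hG.uniqueDiffOn (tangent Ω G y₀)
  rw [← hL.normCov_eq hG.uniqueDiffOn hy₀ i (hT.hom (hT.hom (hT.hom hT))) hT hR]
  refine IsEval.normCov_eq hG hy₀ i (hT.hom (hT.hom (hT.hom (hT.hom smooth_triv))))
    isEval_triv.cons.cons.cons.cons (hL.smooth.clm_apply hR) ?_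
  intro y hy v
  rw [curvatureTensor, ← hG.curvatureL_apply hy]
  rfl

end Eval

/-! ### The geometry of a hypersurface in a coordinate domain -/

section Hypersurface
open Conn

variable {V F W : Type} [NormedAddCommGroup V] [NormedSpace ℝ V] [FiniteDimensional ℝ V]
  [NormedAddCommGroup F] [NormedSpace ℝ F] [FiniteDimensional ℝ F]
  [NormedAddCommGroup W] [NormedSpace ℝ W]

/-- The pullback of a connection along a linear map of the base. -/
def Conn.pull (ι : F →L[ℝ] V) (X : Conn V W) : Conn F W where
  A y := (X.A (ι y)).comp ι
  N := X.N

lemma Conn.pull_A_apply (ι : F →L[ℝ] V) (X : Conn V W) (y x : F) :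
    (X.pull ι).A y x = X.A (ι y) (ι x) := rfl

lemma Conn.pull_hom {U : Type} [NormedAddCommGroup U] [NormedSpace ℝ U] (ι : F →L[ℝ] V)
    (X : Conn V U) (Y : Conn V W) : (hom X Y).pull ι = hom (X.pull ι) (Y.pull ι) := rfl

lemma Conn.pull_triv (ι : F →L[ℝ] V) : (triv V).pull ι = triv F := by
  simp only [Conn.pull, triv, ContinuousLinearMap.zero_comp]

lemma Conn.Normed.pull {X : Conn V W} (h : Normed X) (ι : F →L[ℝ] V) : Normed (X.pull ι) :=
  ⟨h.add_le, h.smul⟩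

/-- The metric induced on the domain of `ι`. -/
def restrictMetric (ι : F →L[ℝ] V) (G : V → V →L[ℝ] V →L[ℝ] ℝ) (y : F) : F →L[ℝ] F →L[ℝ] ℝ :=
  (G (ι y)).bilinearComp ι ι

@[simp] lemma restrictMetric_apply (ι : F →L[ℝ] V) (G : V → V →L[ℝ] V →L[ℝ] ℝ) (y v w : F) :
    restrictMetric ι G y v w = G (ι y) (ι v) (ι w) := rfl

/-- The hyperplane `range ι` of a coordinate domain, with a unit normal field `ν`. -/
structure IsHypersurface (ι : F →L[ℝ] V) (π : V →L[ℝ] F) (Ω : Set V) (Ω' : Set F)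
    (G : V → V →L[ℝ] V →L[ℝ] ℝ) (ν : F → V) : Prop where
  metric : IsMetricOn Ω G
  uniqueDiffOn : UniqueDiffOn ℝ Ω'
  mapsTo : MapsTo ι Ω' Ω
  leftInverse : ∀ x, π (ι x) = x
  smooth_normal : ContDiffOn ℝ ∞ ν Ω'
  normal_unit : ∀ y ∈ Ω', G (ι y) (ν y) (ν y) = 1
  normal_orth : ∀ y ∈ Ω', ∀ x, G (ι y) (ν y) (ι x) = 0
  tangential : ∀ y ∈ Ω', ∀ v, G (ι y) v (ν y) = 0 → ι (π v) = v

/-- The second fundamental form. -/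
def secondL (ι : F →L[ℝ] V) (Ω : Set V) (G : V → V →L[ℝ] V →L[ℝ] ℝ) (ν : F → V) (y : F) :
    F →L[ℝ] F →L[ℝ] ℝ :=
  (ContinuousLinearMap.compL ℝ F V ℝ ((G (ι y)).flip (ν y))).comp
    ((christoffelL Ω G (ι y)).bilinearComp ι ι)

lemma secondL_apply (ι : F →L[ℝ] V) (Ω : Set V) (G : V → V →L[ℝ] V →L[ℝ] ℝ) (ν : F → V) (y x z : F) :
    secondL ι Ω G ν y x z = G (ι y) (christoffelL Ω G (ι y) (ι x) (ι z)) (ν y) := rfl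

variable {ι : F →L[ℝ] V} {π : V →L[ℝ] F} {Ω : Set V} {Ω' : Set F}
  {G : V → V →L[ℝ] V →L[ℝ] ℝ} {ν : F → V} {y₀ : F}

lemma contDiffOn_bilinearComp {f : F → V →L[ℝ] V →L[ℝ] W} (hf : ContDiffOn ℝ ∞ f Ω') :
    ContDiffOn ℝ ∞ (fun y => (f y).bilinearComp ι ι) Ω' :=
  contDiffOn_flip ((contDiffOn_flip (hf.clm_comp contDiffOn_const)).clm_comp contDiffOn_const)

namespace IsHypersurface

lemma contDiffOn_comp (h : IsHypersurface ι π Ω Ω' G ν) {s : V → W} (hs : ContDiffOn ℝ ∞ s Ω) :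
    ContDiffOn ℝ ∞ (fun y => s (ι y)) Ω' := hs.comp ι.contDiff.contDiffOn h.mapsTo

lemma fderivWithin_comp (h : IsHypersurface ι π Ω Ω' G ν) {s : V → W} (hs : ContDiffOn ℝ ∞ s Ω)
    {y : F} (hy : y ∈ Ω') :
    fderivWithin ℝ (fun y => s (ι y)) Ω' y = (fderivWithin ℝ s Ω (ι y)).comp ι :=
  ((hs.differentiableOn (by simp) _ (h.mapsTo hy)).hasFDerivWithinAt.comp y
    ι.hasFDerivWithinAt h.mapsTo).fderivWithin (h.uniqueDiffOn y hy)

lemma smooth_pull (h : IsHypersurface ι π Ω Ω' G ν) {X : Conn V W} (hX : Smooth Ω X) :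
    Smooth Ω' (X.pull ι) := (h.contDiffOn_comp hX).clm_comp contDiffOn_const

lemma injective (h : IsHypersurface ι π Ω Ω' G ν) : Injective ι := LeftInverse.injective h.leftInverse

lemma restrictMetric (h : IsHypersurface ι π Ω Ω' G ν) : IsMetricOn Ω' (restrictMetric ι G) where
  uniqueDiffOn := h.uniqueDiffOn
  smooth := contDiffOn_bilinearComp (h.contDiffOn_comp h.metric.smooth)
  inner _ hy :=
    { symm := fun _ _ => (h.metric.inner _ (h.mapsTo hy)).symm _ _
      pos := fun _ hv => (h.metric.inner _ (h.mapsTo hy)).pos _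
        fun h0 => hv (h.injective (h0.trans (map_zero ι).symm)) }

lemma contDiffOn_secondL (h : IsHypersurface ι π Ω Ω' G ν) :
    ContDiffOn ℝ ∞ (secondL ι Ω G ν) Ω' := by
  have h1 : ContDiffOn ℝ ∞ (fun y => (G (ι y)).flip (ν y)) Ω' :=
    (contDiffOn_flip (h.contDiffOn_comp h.metric.smooth)).clm_apply h.smooth_normal
  have h2 : ContDiffOn ℝ ∞
      (fun y => ContinuousLinearMap.compL ℝ F V ℝ ((G (ι y)).flip (ν y))) Ω' :=
    (ContinuousLinearMap.compL ℝ F V ℝ).contDiff.comp_contDiffOn h1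
  exact h2.clm_comp (contDiffOn_bilinearComp (h.contDiffOn_comp h.metric.contDiffOn_christoffelL))

lemma isometryCompat_pull (h : IsHypersurface ι π Ω Ω' G ν) {W₁ W₂ : Type} [NormedAddCommGroup W₁]
    [NormedSpace ℝ W₁] [NormedAddCommGroup W₂] [NormedSpace ℝ W₂] {X : Conn V W₁} {Y : Conn V W₂}
    {L : V → W₁ →L[ℝ] W₂} (hL : IsometryCompat Ω (ι y₀) X Y L) :
    IsometryCompat Ω' y₀ (X.pull ι) (Y.pull ι) (fun y => L (ι y)) where
  smooth := h.contDiffOn_comp hL.smooth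
  parallel y hy x w := by
    rw [h.fderivWithin_comp hL.smooth hy]
    exact hL.parallel _ (h.mapsTo hy) _ _
  norm_eq := hL.norm_eq

end IsHypersurface

/-- The tangent bundle of the hypersurface. -/
abbrev tanBd (ι : F →L[ℝ] V) (Ω' : Set F) (G : V → V →L[ℝ] V →L[ℝ] ℝ) (y₀ : F) : Conn F F :=
  tangent Ω' (restrictMetric ι G) y₀

/-- The tangent bundle of the ambient space, restricted to the hypersurface. -/
abbrev tanAmb (ι : F →L[ℝ] V) (Ω : Set V) (G : V → V →L[ℝ] V →L[ℝ] ℝ) (y₀ : F) : Conn F V :=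
  (tangent Ω G (ι y₀)).pull ι

/-- The vector valued second fundamental form, as the covariant derivative of the inclusion. -/
def secondVec (ι : F →L[ℝ] V) (Ω : Set V) (Ω' : Set F) (G : V → V →L[ℝ] V →L[ℝ] ℝ) (y₀ y : F) :
    F →L[ℝ] F →L[ℝ] V :=
  covD Ω' (hom (tanBd ι Ω' G y₀) (tanAmb ι Ω G y₀)) (fun _ => ι) y

lemma secondVec_apply (y x z : F) : secondVec ι Ω Ω' G y₀ y x z =
    christoffelL Ω G (ι y) (ι x) (ι z) - ι (christoffelL Ω' (restrictMetric ι G) y x z) := by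
  rw [secondVec, covD_apply, fderivWithin_const_apply]
  simp [tangent, Conn.pull]

/-! ### The equations of Gauss, Weingarten and Codazzi -/

namespace IsHypersurface
variable (h : IsHypersurface ι π Ω Ω' G ν)
include h

lemma smooth_tanBd : Smooth Ω' (tanBd ι Ω' G y₀) := h.restrictMetric.smooth_tangent

lemma smooth_tanAmb : Smooth Ω' (tanAmb ι Ω G y₀) := h.smooth_pull h.metric.smooth_tangent

lemma definite_tanBd (hy₀ : y₀ ∈ Ω') : Definite (tanBd ι Ω' G y₀) := h.restrictMetric.definite hy₀

lemma definite_tanAmb (hy₀ : y₀ ∈ Ω') : Definite (tanAmb ι Ω G y₀) :=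
  (h.metric.inner _ (h.mapsTo hy₀)).definite rfl

lemma contDiffOn_secondVec : ContDiffOn ℝ ∞ (secondVec ι Ω Ω' G y₀) Ω' :=
  contDiffOn_covD h.uniqueDiffOn (h.smooth_tanBd.hom h.smooth_tanAmb) contDiffOn_const

/-- The derivatives of the induced metric are the restrictions of those of `G`, so on tangential
vectors the two Koszul formulas agree: the tangential part of the ambient connection is the induced
one. -/
lemma inner_secondVec_tangential {y : F} (hy : y ∈ Ω') (x z w : F) :
    G (ι y) (secondVec ι Ω Ω' G y₀ y x z) (ι w) = 0 := by
  have h1 := h.restrictMetric.koszul hy x z w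
  have h2 : ∀ a b c, fderivWithin ℝ (BddGeom.restrictMetric ι G) Ω' y a b c =
      fderivWithin ℝ G Ω (ι y) (ι a) (ι b) (ι c) := by
    intro a b c
    rw [← fderivWithin_apply_const₂ h.uniqueDiffOn hy
      (h.restrictMetric.smooth.differentiableOn (by simp) y hy)]
    have h3 := h.fderivWithin_comp (s := fun y => G y (ι b) (ι c))
      ((h.metric.smooth.clm_apply contDiffOn_const).clm_apply contDiffOn_const) hy
    simp only [restrictMetric_apply, h3, ContinuousLinearMap.comp_apply]
    exact fderivWithin_apply_const₂ h.metric.uniqueDiffOn (h.mapsTo hy)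
      (h.metric.smooth.differentiableOn (by simp) _ (h.mapsTo hy)) _ _ _
  rw [restrictMetric_apply, h2, h2, h2] at h1
  rw [secondVec_apply, map_sub, sub_apply, h.metric.koszul (h.mapsTo hy), h1, sub_self]

/-- Gauss' formula: the second fundamental form is normal. -/
lemma secondVec_eq {y : F} (hy : y ∈ Ω') : secondVec ι Ω Ω' G y₀ y =
    liftLeft F (liftLeft F (ContinuousLinearMap.lsmul ℝ ℝ : ℝ →L[ℝ] V →L[ℝ] V))
      (secondL ι Ω G ν y) (ν y) := by
  ext1 x
  ext1 z
  simp only [liftLeft_apply, ContinuousLinearMap.lsmul_apply]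
  have hin := h.metric.inner _ (h.mapsTo hy)
  have hν : G (ι y) (secondVec ι Ω Ω' G y₀ y x z) (ν y) = secondL ι Ω G ν y x z := by
    rw [secondVec_apply, map_sub, sub_apply, hin.symm (ι _) (ν y), h.normal_orth y hy, sub_zero]
    rfl
  set e := secondVec ι Ω Ω' G y₀ y x z with he
  set r := secondL ι Ω G ν y x z
  have h1 : G (ι y) (e - r • ν y) (ν y) = 0 := by
    simp [hν, h.normal_unit y hy]
  have h2 := h.tangential y hy _ h1
  have h3 : ∀ w, G (ι y) (e - r • ν y) (ι w) = 0 := by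
    intro w
    simp only [map_sub, map_smul, sub_apply, smul_apply, h.normal_orth y hy, smul_zero, sub_zero]
    exact h.inner_secondVec_tangential hy x z w
  -- The difference is tangential and orthogonal to all tangential vectors, hence to itself.
  have h4 := h3 (π (e - r • ν y))
  rw [h2] at h4
  by_contra hne
  exact (hin.pos _ (sub_ne_zero.2 hne)).ne' h4

/-- Differentiate the constant function `G(ν, w) = c` and use metric compatibility. -/
lemma covD_normal {y : F} (hy : y ∈ Ω') {w : F → V} (hw : ContDiffOn ℝ ∞ w Ω') {c : ℝ}
    (hc : ∀ y ∈ Ω', G (ι y) (ν y) (w y) = c) (x : F) :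
    G (ι y) (covD Ω' (tanAmb ι Ω G y₀) ν y x) (w y) +
      G (ι y) (ν y) (covD Ω' (tanAmb ι Ω G y₀) w y x) = 0 := by
  have hG := (h.contDiffOn_comp h.metric.smooth).differentiableOn (by simp) y hy
  have hν := h.smooth_normal.differentiableOn (by simp) y hy
  have hw' := hw.differentiableOn (by simp) y hy
  have h1 := ((hG.hasFDerivWithinAt.clm_apply hν.hasFDerivWithinAt).clm_apply
    hw'.hasFDerivWithinAt).fderivWithin (h.uniqueDiffOn y hy)
  rw [fderivWithin_congr (f := fun _ => c) (fun y hy => hc y hy) (hc y hy),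
    fderivWithin_const_apply, h.fderivWithin_comp h.metric.smooth hy] at h1
  have h2 := congrArg (fun f => f x) h1
  simp only [zero_apply, add_apply, ContinuousLinearMap.comp_apply,
    ContinuousLinearMap.flip_apply, h.metric.compat (h.mapsTo hy)] at h2
  simp only [covD_apply, Conn.pull_A_apply, map_add, add_apply]
  simp only [tangent]
  linarith

/-- Weingarten's formula: the derivative of the normal is tangential, and it is given by the second
fundamental form. -/
lemma weingarten {y : F} (hy : y ∈ Ω') :
    covD Ω' (tanAmb ι Ω G y₀) ν y = ι.comp (π.comp (covD Ω' (tanAmb ι Ω G y₀) ν y)) ∧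
      liftMap F (BddGeom.restrictMetric ι G) y (π.comp (covD Ω' (tanAmb ι Ω G y₀) ν y)) =
        -secondL ι Ω G ν y := by
  have hin := h.metric.inner _ (h.mapsTo hy)
  have h1 : ∀ x, ι (π (covD Ω' (tanAmb ι Ω G y₀) ν y x)) = covD Ω' (tanAmb ι Ω G y₀) ν y x := by
    intro x
    refine h.tangential y hy _ ?_
    -- The choice `w = ν`, `c = 1` shows that the derivative of `ν` is orthogonal to `ν`.
    have := h.covD_normal (y₀ := y₀) hy h.smooth_normal (fun y hy => h.normal_unit y hy) x
    rw [hin.symm (ν y)] at this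
    linarith
  refine ⟨by ext1 x; exact (h1 x).symm, ?_⟩
  ext x z
  -- With the constant field `w = ι z` and `c = 0`, the derivative of `w` is a pure Christoffel
  -- term, whose product with `ν` is the second fundamental form.
  have h2 := h.covD_normal (y₀ := y₀) hy (w := fun _ => ι z) contDiffOn_const
    (fun y hy => h.normal_orth y hy z) x
  rw [covD_apply Ω' _ (fun _ => ι z), fderivWithin_const_apply] at h2
  simp only [liftMap_apply, ContinuousLinearMap.comp_apply, restrictMetric_apply, h1, neg_apply,
    secondL_apply]
  simp only [zero_apply, zero_add] at h2
  rw [hin.symm (ν y)] at h2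
  exact eq_neg_of_add_eq_zero_left h2

/-- The equations of Gauss and Codazzi, in the form of a Ricci identity for the inclusion. -/
lemma gauss_codazzi {y : F} (hy : y ∈ Ω') (u v w : F) :
    ι (curvatureL Ω' (BddGeom.restrictMetric ι G) y u v w) =
      curvatureL Ω G (ι y) (ι u) (ι v) (ι w)
      - (covD Ω' (hom (tanBd ι Ω' G y₀) (hom (tanBd ι Ω' G y₀) (tanAmb ι Ω G y₀)))
          (secondVec ι Ω Ω' G y₀) y u v w
        - covD Ω' (hom (tanBd ι Ω' G y₀) (hom (tanBd ι Ω' G y₀) (tanAmb ι Ω G y₀)))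
          (secondVec ι Ω Ω' G y₀) y v u w) := by
  have hb := h.contDiffOn_secondVec (y₀ := y₀) |>.differentiableOn (by simp) y hy
  have hΓ := h.metric.contDiffOn_christoffelL
  have hΓb := h.restrictMetric.contDiffOn_christoffelL
  have key : ∀ a c : F, fderivWithin ℝ (secondVec ι Ω Ω' G y₀) Ω' y a c w =
      fderivWithin ℝ (christoffelL Ω G) Ω (ι y) (ι a) (ι c) (ι w)
        - ι (fderivWithin ℝ (christoffelL Ω' (BddGeom.restrictMetric ι G)) Ω' y a c w) := by
    intro a c
    rw [← fderivWithin_apply_const₂ h.uniqueDiffOn hy hb]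
    simp only [secondVec_apply]
    have h1 : ContDiffOn ℝ ∞ (fun z => christoffelL Ω G z (ι c) (ι w)) Ω :=
      (hΓ.clm_apply contDiffOn_const).clm_apply contDiffOn_const
    have h2 : ContDiffOn ℝ ∞ (fun z => christoffelL Ω' (BddGeom.restrictMetric ι G) z c w) Ω' :=
      (hΓb.clm_apply contDiffOn_const).clm_apply contDiffOn_const
    have h2' := h2.differentiableOn (by simp) y hy
    have h3 := (((h.contDiffOn_comp h1).differentiableOn (by simp) y hy).hasFDerivWithinAt.sub
      (ι.hasFDerivAt.comp_hasFDerivWithinAt y h2'.hasFDerivWithinAt)).fderivWithin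
      (h.uniqueDiffOn y hy)
    have h4 : fderivWithin ℝ (fun z => christoffelL Ω G (ι z) (ι c) (ι w)
      - ι (christoffelL Ω' (BddGeom.restrictMetric ι G) z c w)) Ω' y = _ := h3
    rw [h4, h.fderivWithin_comp h1 hy, sub_apply]
    simp only [ContinuousLinearMap.comp_apply]
    rw [fderivWithin_apply_const₂ h.uniqueDiffOn hy (hΓb.differentiableOn (by simp) y hy),
      fderivWithin_apply_const₂ h.metric.uniqueDiffOn (h.mapsTo hy)
      (hΓ.differentiableOn (by simp) _ (h.mapsTo hy))]
  simp only [covD_apply, add_apply, hom_A_apply, sub_apply, key, secondVec_apply, curvatureL_apply',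
    Conn.pull_A_apply, tangent, map_sub, map_add]
  -- Torsion-freeness removes the terms `b(Γ̄(u, v), w)`; the mixed terms `Γ(u, ι Γ̄(v, w))` cancel
  -- in pairs.
  rw [h.restrictMetric.christoffelL_comm hy v u]
  abel

end IsHypersurface

/-! ### Bounds for the derivatives of the induced curvature -/

/-- The bounds for the derivatives of the inclusion and of the unit normal. -/
def frameBound (K : ℝ≥0∞) : ℕ → ℝ≥0∞
  | 0 => 1
  | i + 1 => frameBound K i + 2 ^ i * (K * frameBound K i)

/-- The bounds for the derivatives of the restriction of a tensor. -/
def restrictBound (K C : ℝ≥0∞) : ℕ → ℝ≥0∞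
  | 0 => C
  | i + 1 => restrictBound K C i + 2 ^ i * (restrictBound K C i * frameBound K i)

lemma frameBound_ne_top {K : ℝ≥0∞} (hK : K ≠ ⊤) (i : ℕ) : frameBound K i ≠ ⊤ := by
  induction i with
  | zero => simp [frameBound]
  | succ i ih => simp [frameBound, ENNReal.mul_eq_top, ih, hK]

lemma restrictBound_ne_top {K C : ℝ≥0∞} (hK : K ≠ ⊤) (hC : C ≠ ⊤) (i : ℕ) :
    restrictBound K C i ≠ ⊤ := by
  induction i with
  | zero => exact hC
  | succ i ih => simp [restrictBound, ENNReal.mul_eq_top, ih, frameBound_ne_top hK]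

/-- The bounds for the derivatives of the curvature of a hypersurface. -/
def curvatureBound (K C : ℝ≥0∞) (i : ℕ) : ℝ≥0∞ :=
  2 ^ i * ((2 ^ i * ((2 ^ i * ((2 ^ i * (restrictBound K C i * frameBound K i)) *
    frameBound K i)) * frameBound K i) + (frameBound K (i + 2) + frameBound K (i + 2)))
    * frameBound K i)

lemma curvatureBound_ne_top {K C : ℝ≥0∞} (hK : K ≠ ⊤) (hC : C ≠ ⊤) (i : ℕ) :
    curvatureBound K C i ≠ ⊤ := by
  simp [curvatureBound, ENNReal.mul_eq_top, frameBound_ne_top hK, restrictBound_ne_top hK hC]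

namespace IsHypersurface
variable (h : IsHypersurface ι π Ω Ω' G ν) {K : ℝ≥0∞}
include h

/-- Simultaneous induction for `ι` and `ν`: by the formulas of Gauss and Weingarten a derivative of
order `i + 1` of one of them is a derivative of order `i` of a product of the other with `l` or the
shape operator. Hence only orders of `l` below `i` enter. -/
lemma normCov_frame_le (hy₀ : y₀ ∈ Ω') (i : ℕ)
    (hK : ∀ j < i, normCov Ω' (tanBd ι Ω' G y₀) y₀ j
      (hom (tanBd ι Ω' G y₀) (hom (tanBd ι Ω' G y₀) (triv F))) (secondL ι Ω G ν) ≤ K) :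
    ∀ j ≤ i, normCov Ω' (tanBd ι Ω' G y₀) y₀ j (hom (tanBd ι Ω' G y₀) (tanAmb ι Ω G y₀))
        (fun _ => ι) ≤ frameBound K i ∧
      normCov Ω' (tanBd ι Ω' G y₀) y₀ j (tanAmb ι Ω G y₀) ν ≤ frameBound K i := by
  have hB := h.smooth_tanBd (y₀ := y₀)
  have hA := h.smooth_tanAmb (y₀ := y₀)
  have hl := h.contDiffOn_secondL
  have hΩ := h.uniqueDiffOn
  induction i with
  | zero =>
    intro j hj
    obtain rfl := Nat.le_zero.1 hj
    refine ⟨iSup₂_le fun u hu => hu, ?_⟩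
    change vecNorm _ _ ≤ 1
    rw [vecNorm_le_one, h.normal_unit y₀ hy₀]
  | succ i ih =>
    have ih' := ih fun j hj => hK j (by omega)
    intro j hj
    rcases Nat.le_succ_iff.1 hj with hj | rfl
    · exact ⟨(ih' j hj).1.trans le_self_add, (ih' j hj).2.trans le_self_add⟩
    constructor
    · refine le_trans ?_ le_add_self
      change normCov Ω' (tanBd ι Ω' G y₀) y₀ i _ (secondVec ι Ω Ω' G y₀) ≤ _
      rw [normCov_congr hy₀ i _ (fun y hy => h.secondVec_eq hy)]
      exact normCov_bilin_le hΩ hy₀ hB i (hB.hom (hB.hom smooth_triv)) hA (hB.hom (hB.hom hA))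
        (Normed.hom _ (Normed.hom _ (h.definite_tanAmb hy₀).toNormed))
        (((bilinCompat_lsmul (h.definite_tanAmb hy₀).toNormed).liftLeft _).liftLeft _) hl
        h.smooth_normal (fun j hj => hK j (by omega)) (fun j hj => (ih' j hj).2)
    · refine le_trans ?_ le_add_self
      change normCov Ω' (tanBd ι Ω' G y₀) y₀ i _ (covD Ω' (tanAmb ι Ω G y₀) ν) ≤ _
      have hD := contDiffOn_covD hΩ hA h.smooth_normal
      have hS : ContDiffOn ℝ ∞ (fun y => π.comp (covD Ω' (tanAmb ι Ω G y₀) ν y)) Ω' :=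
        contDiffOn_const.clm_comp hD
      -- Lowering an index turns the shape operator into `-l`, and neither the lowering nor the sign
      -- affects the norms of derivatives.
      have hSK : ∀ j ≤ i, normCov Ω' (tanBd ι Ω' G y₀) y₀ j
          (hom (tanBd ι Ω' G y₀) (tanBd ι Ω' G y₀))
          (fun y => π.comp (covD Ω' (tanAmb ι Ω G y₀) ν y)) ≤ K := by
        intro j hj
        rw [← ((h.restrictMetric.isometryCompat hy₀).lift hΩ (tanBd ι Ω' G y₀)).normCov_eq hΩ hy₀ j
          (hB.hom hB) hB hS, normCov_congr hy₀ j _ (fun y hy => (h.weingarten hy).2)]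
        have h1 := (isometryCompat_neg (Ω := Ω') (y₀ := y₀) (Normed.hom (tanBd ι Ω' G y₀)
          (Normed.hom (tanBd ι Ω' G y₀) normed_triv))).normCov_eq hΩ hy₀ j
          (hB.hom (hB.hom smooth_triv)) hB hl
        exact h1.le.trans (hK j (by omega))
      rw [normCov_congr hy₀ i _ (fun y hy => (h.weingarten hy).1), mul_comm K]
      exact normCov_bilin_le hΩ hy₀ hB i (hB.hom hA) (hB.hom hB) (hB.hom hA)
        (Normed.hom _ (h.definite_tanAmb hy₀).toNormed)
        (bilinCompat_comp (h.definite_tanBd hy₀) (h.definite_tanAmb hy₀).toNormed _)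
        contDiffOn_const hS (fun j hj => (ih' j hj).1) hSK

/-- By the chain rule the derivative of a restricted section is its ambient derivative, restricted
and composed with `ι`. The induction hypothesis applies to the ambient derivative as a section of a
new bundle, and the Leibniz estimate handles the factor `ι`. -/
lemma normCov_restrict_le (hy₀ : y₀ ∈ Ω') (i : ℕ)
    (hK : ∀ j < i, normCov Ω' (tanBd ι Ω' G y₀) y₀ j
      (hom (tanBd ι Ω' G y₀) (hom (tanBd ι Ω' G y₀) (triv F))) (secondL ι Ω G ν) ≤ K)
    {X : Conn V W} (hX : Smooth Ω X) (hN : Normed X) {s : V → W} (hs : ContDiffOn ℝ ∞ s Ω)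
    {C : ℝ≥0∞} (hC : ∀ j ≤ i, normCov Ω (tangent Ω G (ι y₀)) (ι y₀) j X s ≤ C) :
    ∀ j ≤ i, normCov Ω' (tanBd ι Ω' G y₀) y₀ j (X.pull ι) (fun y => s (ι y)) ≤
      restrictBound K C i := by
  have hB := h.smooth_tanBd (y₀ := y₀)
  have hA := h.smooth_tanAmb (y₀ := y₀)
  have hΩ := h.uniqueDiffOn
  induction i generalizing W with
  | zero =>
    intro j hj
    obtain rfl := Nat.le_zero.1 hj
    exact hC 0 le_rfl
  | succ i ih =>
    intro j hj
    have hK' : ∀ j < i, _ := fun j hj => hK j (by omega)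
    rcases Nat.le_succ_iff.1 hj with hj | rfl
    · exact (ih hK' hX hN hs (fun j hj => hC j (by omega)) j hj).trans le_self_add
    refine le_trans ?_ le_add_self
    have hD := contDiffOn_covD h.metric.uniqueDiffOn hX hs
    have hT : Smooth Ω (tangent Ω G (ι y₀)) := h.metric.smooth_tangent
    have h1 := ih hK' (hT.hom hX) (Normed.hom _ hN) hD (fun j hj => hC (j + 1) (by omega))
    have h2 : EqOn (covD Ω' (X.pull ι) (fun y => s (ι y)))
        (fun y => ContinuousLinearMap.compL ℝ F V W (covD Ω X s (ι y)) ι) Ω' := by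
      intro y hy
      ext x
      rw [covD_apply, h.fderivWithin_comp hs hy]
      rfl
    simp only [normCov]
    rw [normCov_congr hy₀ i _ h2]
    exact normCov_bilin_le hΩ hy₀ hB i (hA.hom (h.smooth_pull hX)) (hB.hom hA)
      (hB.hom (h.smooth_pull hX)) (Normed.hom _ (hN.pull ι))
      (bilinCompat_comp (h.definite_tanAmb hy₀) (hN.pull ι) _) (h.contDiffOn_comp hD)
      contDiffOn_const h1 (fun j hj => (h.normCov_frame_le hy₀ i hK' j hj).1)

set_option maxHeartbeats 1000000 in
/-- The derivatives of the curvature of a hypersurface are bounded in terms of those of the ambient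
curvature and of the second fundamental form. -/
lemma normCov_curvatureL_le (hy₀ : y₀ ∈ Ω') (i : ℕ)
    (hK : ∀ j < i + 2, normCov Ω' (tanBd ι Ω' G y₀) y₀ j
      (hom (tanBd ι Ω' G y₀) (hom (tanBd ι Ω' G y₀) (triv F))) (secondL ι Ω G ν) ≤ K) {C : ℝ≥0∞}
    (hC : ∀ j ≤ i, normCov Ω (tangent Ω G (ι y₀)) (ι y₀) j (hom (tangent Ω G (ι y₀))
      (hom (tangent Ω G (ι y₀)) (hom (tangent Ω G (ι y₀)) (tangent Ω G (ι y₀)))))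
      (curvatureL Ω G) ≤ C) :
    normCov Ω' (tanBd ι Ω' G y₀) y₀ i (hom (tanBd ι Ω' G y₀) (hom (tanBd ι Ω' G y₀)
      (hom (tanBd ι Ω' G y₀) (tanBd ι Ω' G y₀)))) (curvatureL Ω' (BddGeom.restrictMetric ι G)) ≤
    curvatureBound K C i := by
  set B := tanBd ι Ω' G y₀ with hBdef
  set A := tanAmb ι Ω G y₀ with hAdef
  have hB : Smooth Ω' B := h.smooth_tanBd
  have hA : Smooth Ω' A := h.smooth_tanAmb
  have hBd : Definite B := h.definite_tanBd hy₀
  have hAd : Definite A := h.definite_tanAmb hy₀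
  have hΩ := h.uniqueDiffOn
  have hT : Smooth Ω (tangent Ω G (ι y₀)) := h.metric.smooth_tangent
  have hTd : Definite (tangent Ω G (ι y₀)) := h.metric.definite (h.mapsTo hy₀)
  have hι : ∀ j ≤ i, normCov Ω' B y₀ j (hom B A) (fun _ => ι) ≤ frameBound K i :=
    fun j hj => (h.normCov_frame_le hy₀ i (fun j hj => hK j (by omega)) j hj).1
  -- the ambient curvature with tangential arguments
  have hR0 := h.contDiffOn_comp h.metric.contDiffOn_curvatureL
  have b0 := h.normCov_restrict_le hy₀ i (fun j hj => hK j (by omega))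
    (hT.hom (hT.hom (hT.hom hT)))
    (Normed.hom _ (Normed.hom _ (Normed.hom _ hTd.toNormed))) h.metric.contDiffOn_curvatureL hC
  -- The three arguments are made tangential one at a time by composing with `ι`; each `liftLeft`
  -- passes over an argument already treated.
  have c1 : BilinCompat Ω' (hom A (hom A (hom A A))) (hom B A) (hom B (hom A (hom A A))) _ :=
    bilinCompat_comp hAd (Normed.hom _ (Normed.hom _ hAd.toNormed)) B
  have c2 : BilinCompat Ω' (hom B (hom A (hom A A))) (hom B A) (hom B (hom B (hom A A))) _ :=
    (bilinCompat_comp hAd (Normed.hom _ hAd.toNormed) B).liftLeft B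
  have c3 : BilinCompat Ω' (hom B (hom B (hom A A))) (hom B A) (hom B (hom B (hom B A))) _ :=
    ((bilinCompat_comp hAd hAd.toNormed B).liftLeft B).liftLeft B
  have hR1 := contDiffOn_bilin (ContinuousLinearMap.compL ℝ F V (V →L[ℝ] V →L[ℝ] V)) hR0
    (contDiffOn_const (c := ι))
  have hR2 := contDiffOn_bilin (liftLeft F (ContinuousLinearMap.compL ℝ F V (V →L[ℝ] V))) hR1
    (contDiffOn_const (c := ι))
  have hR3 := contDiffOn_bilin (liftLeft F (liftLeft F (ContinuousLinearMap.compL ℝ F V V))) hR2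
    (contDiffOn_const (c := ι))
  -- The next application of the Leibniz estimate needs one bound for all orders `j ≤ i`.
  have two : ∀ j ≤ i, ∀ a : ℝ≥0∞, 2 ^ j * a ≤ 2 ^ i * a := fun j hj a => by
    gcongr
    exact one_le_two
  have b1 : ∀ j ≤ i, _ := fun j hj => (normCov_bilin_le hΩ hy₀ hB j (hA.hom (hA.hom (hA.hom hA)))
    (hB.hom hA) (hB.hom (hA.hom (hA.hom hA))) (Normed.hom _ (Normed.hom _ (Normed.hom _ hAd.toNormed)))
    c1 hR0 contDiffOn_const (fun k hk => b0 k (hk.trans hj)) (fun k hk => hι k (hk.trans hj))).trans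
      (two j hj _)
  have b2 : ∀ j ≤ i, _ := fun j hj => (normCov_bilin_le hΩ hy₀ hB j (hB.hom (hA.hom (hA.hom hA)))
    (hB.hom hA) (hB.hom (hB.hom (hA.hom hA))) (Normed.hom _ (Normed.hom _ (Normed.hom _ hAd.toNormed)))
    c2 hR1 contDiffOn_const (fun k hk => b1 k (hk.trans hj)) (fun k hk => hι k (hk.trans hj))).trans
      (two j hj _)
  have b3 : ∀ j ≤ i, _ := fun j hj => (normCov_bilin_le hΩ hy₀ hB j (hB.hom (hB.hom (hA.hom hA)))
    (hB.hom hA) (hB.hom (hB.hom (hB.hom hA))) (Normed.hom _ (Normed.hom _ (Normed.hom _ hAd.toNormed)))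
    c3 hR2 contDiffOn_const (fun k hk => b2 k (hk.trans hj)) (fun k hk => hι k (hk.trans hj))).trans
      (two j hj _)
  -- the antisymmetrized derivative of the second fundamental form
  have hBBA := hB.hom (hB.hom hA)
  have hD : ContDiffOn ℝ ∞ (covD Ω' (hom B (hom B A)) (secondVec ι Ω Ω' G y₀)) Ω' :=
    contDiffOn_covD hΩ hBBA h.contDiffOn_secondVec
  -- Since `b` is the first derivative of `ι`, the derivative of order `j` of `∇b` is that of order
  -- `j + 2` of `ι`.
  have d0 : ∀ j ≤ i, normCov Ω' B y₀ j (hom B (hom B (hom B A)))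
      (covD Ω' (hom B (hom B A)) (secondVec ι Ω Ω' G y₀)) ≤ frameBound K (i + 2) := fun j hj =>
    (h.normCov_frame_le hy₀ (i + 2) hK (j + 2) (by omega)).1
  have hflip := isometryCompat_flip (Ω := Ω') (y₀ := y₀) B (hom B A)
  have hD' := contDiffOn_flip hD
  have d1 : ∀ j ≤ i, normCov Ω' B y₀ j (hom B (hom B (hom B A)))
      (fun y => (covD Ω' (hom B (hom B A)) (secondVec ι Ω Ω' G y₀) y).flip) ≤
        frameBound K (i + 2) := fun j hj =>
    (hflip.normCov_eq hΩ hy₀ j (hB.hom hBBA) hB hD).le.trans (d0 j hj)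
  have hN3 := Normed.hom B (Normed.hom B (Normed.hom B hAd.toNormed))
  have d2 : ∀ j ≤ i, _ := fun j hj => (normCov_sub_le hΩ hy₀ hB j (hB.hom hBBA) hN3 hD hD').trans
    (add_le_add (d0 j hj) (d1 j hj))
  have z1 : ∀ j ≤ i, _ := fun j hj => (normCov_sub_le hΩ hy₀ hB j (hB.hom hBBA) hN3 hR3
    (hD.sub hD')).trans (add_le_add (b3 j hj) (d2 j hj))
  have hZ := hR3.sub (hD.sub hD')
  -- lowering the index
  have hlow0 := h.isometryCompat_pull (h.metric.isometryCompat (h.mapsTo hy₀))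
  rw [Conn.pull_hom, Conn.pull_triv] at hlow0
  have hlow := ((hlow0.lift hΩ B).lift hΩ B).lift hΩ B
  have z2 := fun j hj => (hlow.normCov_eq hΩ hy₀ j (hB.hom hBBA) hB hZ).le.trans (z1 j hj)
  have hZ' := hlow.smooth.clm_apply hZ
  -- Composing the lowered last argument with `ι` yields the covariant curvature tensor of the
  -- hypersurface, so no bound for the projection `π` is needed.
  have c4 : BilinCompat Ω' (hom B (hom B (hom B (hom A (triv F))))) (hom B A)
      (hom B (hom B (hom B (hom B (triv F))))) _ :=
    (((bilinCompat_comp hAd normed_triv B).liftLeft B).liftLeft B).liftLeft B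
  have z3 := normCov_bilin_le hΩ hy₀ hB i (hB.hom (hB.hom (hB.hom (hA.hom smooth_triv))))
    (hB.hom hA) (hB.hom (hB.hom (hB.hom (hB.hom smooth_triv))))
    (Normed.hom B (Normed.hom B (Normed.hom B (Normed.hom B normed_triv)))) c4 hZ'
    (contDiffOn_const (c := ι)) z2 hι
  refine le_trans (le_of_eq ?_) z3
  -- Lowering with the induced metric preserves the norms, so it suffices to compare covariant
  -- tensors, where `gauss_codazzi` applies.
  have hlowB := (((h.restrictMetric.isometryCompat hy₀).lift hΩ B).lift hΩ B).lift hΩ B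
  rw [← hlowB.normCov_eq hΩ hy₀ i (hB.hom (hB.hom (hB.hom hB))) hB
    h.restrictMetric.contDiffOn_curvatureL]
  refine normCov_congr hy₀ i _ fun y hy => ?_
  ext u v w z
  simp only [liftMap_apply, liftLeft_apply, restrictMetric_apply,
    h.gauss_codazzi (y₀ := y₀) hy]
  rfl

end IsHypersurface
end Hypersurface

/-! ### The metric of a Riemannian manifold in a chart -/

section Chart
open Conn

variable {E : Type} [NormedAddCommGroup E] [NormedSpace ℝ E] [FiniteDimensional ℝ E]
  {H : Type*} [TopologicalSpace H] (I : ModelWithCorners ℝ E H)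
  {M : Type*} [TopologicalSpace M] [ChartedSpace H M] [IsManifold I ∞ M]
  (g : Bundle.ContMDiffRiemannianMetric I ∞ E (fun x : M => TangentSpace I x))

lemma chartMetric_apply (x : M) (y v w : E) : chartMetric I g x y v w =
    g.inner ((extChartAt I x).symm y)
      (mfderivWithin 𝓘(ℝ, E) I (extChartAt I x).symm (range I) y v)
      (mfderivWithin 𝓘(ℝ, E) I (extChartAt I x).symm (range I) y w) := rfl

lemma range_eventuallyEq_target (x : M) {y : E} (hy : y ∈ (extChartAt I x).target) :
    range I =ᶠ[nhds y] (extChartAt I x).target :=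
  (extChartAt_target_eventuallyEq_of_mem hy).symm

/-- The tangent map of the inverse chart is applied to a constant vector field; in this form the
frame can be inserted into `g` as a smooth section. -/
lemma contMDiffOn_chartFrame (x : M) (v : E) :
    ContMDiffOn 𝓘(ℝ, E) I.tangent ∞ (fun y => (⟨(extChartAt I x).symm y,
      mfderivWithin 𝓘(ℝ, E) I (extChartAt I x).symm (range I) y v⟩ : TangentBundle I M))
      (extChartAt I x).target := by
  have h1 := (contMDiffOn_extChartAt_symm (I := I) (n := ∞) x).contMDiffOn_tangentMapWithin
    (m := ∞) (by simp) (uniqueDiffOn_extChartAt_target x).uniqueMDiffOn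
  have h2 : ContMDiffOn 𝓘(ℝ, E) 𝓘(ℝ, E).tangent ∞
      (fun y : E => (⟨y, v⟩ : TangentBundle 𝓘(ℝ, E) E)) (extChartAt I x).target := fun y _ =>
    contMDiffWithinAt_vectorSpace_iff_contDiffWithinAt.2 contDiffWithinAt_const
  refine (h1.comp h2 fun y hy => hy).congr fun y hy => ?_
  have h3 : mfderivWithin 𝓘(ℝ, E) I (extChartAt I x).symm (range I) y =
      mfderivWithin 𝓘(ℝ, E) I (extChartAt I x).symm (extChartAt I x).target y :=
    mfderivWithin_congr_set (range_eventuallyEq_target I x hy)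
  rw [h3]
  rfl

lemma contDiffOn_chartMetric_apply (x : M) (v w : E) :
    ContDiffOn ℝ ∞ (fun y => chartMetric I g x y v w) (extChartAt I x).target := by
  have h0 : ContMDiffOn 𝓘(ℝ, E) (I.prod 𝓘(ℝ, E →L[ℝ] E →L[ℝ] ℝ)) ∞
      (fun y => Bundle.TotalSpace.mk' (E →L[ℝ] E →L[ℝ] ℝ)
        (E := fun x : M => TangentSpace I x →L[ℝ] TangentSpace I x →L[ℝ] ℝ)
        ((extChartAt I x).symm y) (g.inner ((extChartAt I x).symm y))) (extChartAt I x).target :=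
    g.contMDiff.comp_contMDiffOn (contMDiffOn_extChartAt_symm (I := I) (n := ∞) x)
  intro y hy
  have h1 := ContMDiffWithinAt.clm_bundle_apply₂ (F₁ := E) (F₂ := E) (F₃ := ℝ)
    (E₁ := fun x : M => TangentSpace I x) (E₂ := fun x : M => TangentSpace I x)
    (E₃ := Bundle.Trivial M ℝ) (h0 y hy) (contMDiffOn_chartFrame I x v y hy)
    (contMDiffOn_chartFrame I x w y hy)
  rw [Bundle.contMDiffWithinAt_totalSpace] at h1
  exact contMDiffWithinAt_iff_contDiffWithinAt.1 h1.2

lemma contDiffOn_chartMetric (x : M) :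
    ContDiffOn ℝ ∞ (chartMetric I g x) (extChartAt I x).target :=
  contDiffOn_clm_apply.2 fun v => contDiffOn_clm_apply.2 fun w =>
    contDiffOn_chartMetric_apply I g x v w

lemma chartFrame_ne_zero (x : M) {y : E} (hy : y ∈ (extChartAt I x).target) {v : E} (hv : v ≠ 0) :
    mfderivWithin 𝓘(ℝ, E) I (extChartAt I x).symm (range I) y v ≠ 0 := by
  intro h0
  have h1 := (isInvertible_mfderivWithin_extChartAt_symm (I := I) hy).injective
  exact hv (h1 (h0.trans (map_zero _).symm))

lemma isInner_chartMetric (x : M) {y : E} (hy : y ∈ (extChartAt I x).target) :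
    IsInner (chartMetric I g x y) where
  symm v w := by
    rw [chartMetric_apply, chartMetric_apply]
    exact g.symm _ _ _
  pos v hv := by
    rw [chartMetric_apply]
    exact g.pos _ _ (chartFrame_ne_zero I x hy hv)

lemma isMetricOn_chartMetric (x : M) :
    IsMetricOn (extChartAt I x).target (chartMetric I g x) where
  uniqueDiffOn := uniqueDiffOn_extChartAt_target x
  smooth := contDiffOn_chartMetric I g x
  inner _ hy := isInner_chartMetric I g x hy

/-- All tangent spaces are definitionally `E`, which makes the metrics at propositionally equal
points comparable. -/
lemma inner_congr {x x' : M} (h : x' = x) (v w : E) : (g.inner x' : E →L[ℝ] E →L[ℝ] ℝ) v w =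
    (g.inner x : E →L[ℝ] E →L[ℝ] ℝ) v w := by subst h; rfl

lemma chartMetric_self (x : M) : chartMetric I g x (extChartAt I x x) = g.inner x := by
  ext v w
  rw [chartMetric_apply, mfderivWithin_range_extChartAt_symm]
  exact inner_congr I g (extChartAt_to_inv x) v w

lemma normNablaR_eq (i : ℕ) (x : M) :
    normNablaR I g i x = tensorNorm (chartMetric I g x (extChartAt I x x))
      (iterCovDeriv (range I) (chartMetric I g x) (curvatureTensor (range I) (chartMetric I g x)) i
        (extChartAt I x x)) := by
  rw [chartMetric_self]
  rfl

/-- The base point and the connection are variables subject to equations, so that the base point may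
be given as the image of a boundary coordinate under `bdIncl`. -/
lemma normNablaR_eq_normCov (i : ℕ) (x : M) {y₀ : E} (hy₀ : y₀ = extChartAt I x x)
    {T : Conn E E}
    (hT : T = tangent (extChartAt I x).target (chartMetric I g x) y₀) :
    normNablaR I g i x = normCov (extChartAt I x).target T y₀ i (hom T (hom T (hom T T)))
      (curvatureL (extChartAt I x).target (chartMetric I g x)) := by
  subst hT hy₀
  rw [(isMetricOn_chartMetric I g x).normCov_curvatureL (mem_extChartAt_target x), normNablaR_eq,
    iterCovDeriv_congr (fun y hy => range_eventuallyEq_target I x hy) (fun _ _ => rfl)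
    (curvatureTensor_congr (fun y hy => range_eventuallyEq_target I x hy) (fun _ _ => rfl)) i
    (mem_extChartAt_target x)]

end Chart

/-! ### The boundary in a chart -/

section BoundaryChart
open Conn

variable {n : ℕ} {M : Type*} [TopologicalSpace M] [ChartedSpace (EuclideanHalfSpace (n + 1)) M]
  [IsManifold (𝓡∂ (n + 1)) ∞ M]
  (g : Bundle.ContMDiffRiemannianMetric (𝓡∂ (n + 1)) ∞ (EuclideanSpace ℝ (Fin (n + 1)))
    (fun x : M => TangentSpace (𝓡∂ (n + 1)) x))

lemma halfSpace_symm_bdIncl (y : EuclideanSpace ℝ (Fin n)) :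
    (𝓡∂ (n + 1)).symm (bdIncl n y) = bdPt y := (𝓡∂ (n + 1)).left_inv (bdPt y)

lemma mapsTo_bdIncl (p : Bd n M) :
    MapsTo (bdIncl n) (bdChart p).target (extChartAt (𝓡∂ (n + 1)) p.1).target := by
  intro y hy
  rw [extChartAt_target]
  refine ⟨?_, ⟨bdPt y, rfl⟩⟩
  rw [mem_preimage, halfSpace_symm_bdIncl]
  exact hy

lemma bdIncl_extChartAt (p : Bd n M) :
    bdIncl n (extChartAt (𝓡 n) p p) = extChartAt (𝓡∂ (n + 1)) p.1 p.1 :=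
  congrArg Subtype.val (bdPt_bdProj p (mem_chart_source (EuclideanHalfSpace (n + 1)) p.1))

lemma extChartAt_mem_bdChart_target (p : Bd n M) :
    extChartAt (𝓡 n) p p ∈ (bdChart p).target :=
  (bdChart p).map_source (mem_chart_source (EuclideanSpace ℝ (Fin n)) p)

lemma bdInv_val_eq (p : Bd n M) {y : EuclideanSpace ℝ (Fin n)} (hy : y ∈ (bdChart p).target) :
    ((extChartAt (𝓡 n) p).symm y).1 = (extChartAt (𝓡∂ (n + 1)) p.1).symm (bdIncl n y) := by
  change (bdInv p y).1 = (chartAt (EuclideanHalfSpace (n + 1)) p.1).symm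
    ((𝓡∂ (n + 1)).symm (bdIncl n y))
  rw [halfSpace_symm_bdIncl, bdInv_val p hy]

lemma bdChart_target_subset (p : Bd n M) :
    (bdChart p).target ⊆ (extChartAt (𝓡 n) p).target := by
  intro y hy
  rw [extChartAt_target]
  exact ⟨hy, ⟨y, rfl⟩⟩

/-- The coordinate frames of `∂M` and `M` are related by the inclusion. -/
lemma bdVal_chartFrame (p : Bd n M) {y : EuclideanSpace ℝ (Fin n)} (hy : y ∈ (bdChart p).target)
    (v : EuclideanSpace ℝ (Fin n)) :
    (mfderiv (𝓡 n) (𝓡∂ (n + 1)) (Subtype.val : Bd n M → M) ((extChartAt (𝓡 n) p).symm y)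
      (mfderivWithin 𝓘(ℝ, EuclideanSpace ℝ (Fin n)) (𝓡 n) (extChartAt (𝓡 n) p).symm
        (range (𝓡 n)) y v) : EuclideanSpace ℝ (Fin (n + 1))) =
    mfderivWithin 𝓘(ℝ, EuclideanSpace ℝ (Fin (n + 1))) (𝓡∂ (n + 1))
      (extChartAt (𝓡∂ (n + 1)) p.1).symm (range (𝓡∂ (n + 1))) (bdIncl n y) (bdIncl n v) := by
  have h1 : HasMFDerivWithinAt 𝓘(ℝ, EuclideanSpace ℝ (Fin n)) (𝓡∂ (n + 1))
      (Subtype.val ∘ (extChartAt (𝓡 n) p).symm) (range (𝓡 n)) y _ :=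
    ((contMDiff_bdVal (n := n) (M := M) _).mdifferentiableAt (by simp)).hasMFDerivAt.comp_hasMFDerivWithinAt
      y (mdifferentiableWithinAt_extChartAt_symm (bdChart_target_subset p hy)).hasMFDerivWithinAt
  have h2 : HasMFDerivWithinAt 𝓘(ℝ, EuclideanSpace ℝ (Fin n)) (𝓡∂ (n + 1))
      ((extChartAt (𝓡∂ (n + 1)) p.1).symm ∘ bdIncl n) (range (𝓡 n)) y _ :=
    (mdifferentiableWithinAt_extChartAt_symm (mapsTo_bdIncl p hy)).hasMFDerivWithinAt.comp y
      (bdIncl n).hasMFDerivWithinAt (fun z _ => ⟨bdPt z, rfl⟩)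
  have h3 : (Subtype.val ∘ (extChartAt (𝓡 n) p).symm) =ᶠ[nhdsWithin y (range (𝓡 n))]
      ((extChartAt (𝓡∂ (n + 1)) p.1).symm ∘ bdIncl n) :=
    Filter.eventuallyEq_of_mem (mem_nhdsWithin_of_mem_nhds ((bdChart p).open_target.mem_nhds hy))
      fun z hz => bdInv_val_eq p hz
  have h4 := h2.congr_of_eventuallyEq h3 (bdInv_val_eq p hy)
  have h5 : UniqueMDiffWithinAt 𝓘(ℝ, EuclideanSpace ℝ (Fin n)) (range (𝓡 n)) y :=
    ((𝓡 n).uniqueDiffOn y ⟨y, rfl⟩).uniqueMDiffWithinAt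
  have h6 := h5.eq h1 h4
  exact congrArg (fun L : EuclideanSpace ℝ (Fin n) →L[ℝ] EuclideanSpace ℝ (Fin (n + 1)) => L v) h6

/-- Identifies the intrinsic coordinates of `∂M` with the hypersurface picture, by means of the
matching frames of `bdVal_chartFrame`. -/
lemma chartMetric_inducedMetric (p : Bd n M) :
    EqOn (chartMetric (𝓡 n) (inducedMetric g) p)
      (restrictMetric (bdIncl n) (chartMetric (𝓡∂ (n + 1)) g p.1)) (bdChart p).target := by
  intro y hy
  ext v w
  rw [chartMetric_apply, restrictMetric_apply, chartMetric_apply]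
  have h := inner_congr (𝓡∂ (n + 1)) g (bdInv_val_eq p hy)
  rw [← bdVal_chartFrame p hy, ← bdVal_chartFrame p hy]
  exact h _ _

/-- The normal is a positive multiple of the gradient of the zeroth coordinate, so orthogonality to
it means that this coordinate vanishes. The positivity also gives smoothness of the square root in
the normal field. -/
lemma apply_inwardNormal {B : EuclideanSpace ℝ (Fin (n + 1)) →L[ℝ]
    EuclideanSpace ℝ (Fin (n + 1)) →L[ℝ] ℝ} (hB : IsInner B) :
    0 < B.inverse (EuclideanSpace.proj 0) 0 ∧ ∀ v, B v (inwardNormal B) =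
      (√(B.inverse (EuclideanSpace.proj 0) 0))⁻¹ * v 0 := by
  have h1 := apply_inverse_of_pos B hB.pos (EuclideanSpace.proj 0)
  constructor
  · have h2 : B (B.inverse (EuclideanSpace.proj 0)) (B.inverse (EuclideanSpace.proj 0)) =
        B.inverse (EuclideanSpace.proj 0) 0 := by rw [h1]; rfl
    rw [← h2]
    refine hB.pos _ fun h0 => ?_
    rw [h0, map_zero] at h1
    have := congrArg (fun f => f (EuclideanSpace.single 0 1)) h1
    simp at this
  · intro v
    rw [hB.symm, inwardNormal, map_smul, smul_apply, h1]
    rfl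

/-- In a chart, the boundary of `M` is a hyperplane. -/
lemma isHypersurface_boundary (p : Bd n M) :
    IsHypersurface (bdIncl n) (bdProj n) (extChartAt (𝓡∂ (n + 1)) p.1).target (bdChart p).target
      (chartMetric (𝓡∂ (n + 1)) g p.1)
      (fun y => inwardNormal (chartMetric (𝓡∂ (n + 1)) g p.1 (bdIncl n y))) := by
  have hG := isMetricOn_chartMetric (𝓡∂ (n + 1)) g p.1
  have hin := fun y (hy : y ∈ (bdChart p).target) => hG.inner _ (mapsTo_bdIncl p hy)
  refine ⟨hG, (bdChart p).open_target.uniqueDiffOn, mapsTo_bdIncl p, bdProj_bdIncl, ?_,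
    fun y hy => (inwardNormal_spec _ (hin y hy).pos).2.1,
    fun y hy => (inwardNormal_spec _ (hin y hy).pos).1, ?_⟩
  · have h1 : ContDiffOn ℝ ∞ (fun y => (chartMetric (𝓡∂ (n + 1)) g p.1 (bdIncl n y)).inverse
        (EuclideanSpace.proj 0)) (bdChart p).target :=
      (hG.contDiffOn_inverse.comp (bdIncl n).contDiff.contDiffOn (mapsTo_bdIncl p)).clm_apply
        contDiffOn_const
    have h2 : ContDiffOn ℝ ∞ (fun y => (chartMetric (𝓡∂ (n + 1)) g p.1 (bdIncl n y)).inverse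
        (EuclideanSpace.proj 0) 0) (bdChart p).target :=
      (EuclideanSpace.proj (𝕜 := ℝ) (0 : Fin (n + 1))).contDiff.comp_contDiffOn h1
    exact ((h2.sqrt fun y hy => (apply_inwardNormal (hin y hy)).1.ne').inv fun y hy =>
      (Real.sqrt_pos.2 (apply_inwardNormal (hin y hy)).1).ne').smul h1
  · intro y hy v hv
    obtain ⟨h1, h2⟩ := apply_inwardNormal (hin y hy)
    rw [h2] at hv
    exact bdIncl_bdProj ((mul_eq_zero.1 hv).resolve_left (inv_ne_zero (Real.sqrt_pos.2 h1).ne'))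

lemma range_eventuallyEq_bdChart_target (p : Bd n M) :
    ∀ y ∈ (bdChart p).target, range (𝓡 n) =ᶠ[nhds y] (bdChart p).target := by
  intro y hy
  filter_upwards [(bdChart p).open_target.mem_nhds hy] with z hz
  exact propext ⟨fun _ => hz, fun _ => ⟨z, rfl⟩⟩

lemma inducedMetric_inner_eq (p : Bd n M) :
    ((inducedMetric g).inner p : EuclideanSpace ℝ (Fin n) →L[ℝ] EuclideanSpace ℝ (Fin n) →L[ℝ] ℝ) =
      restrictMetric (bdIncl n) (chartMetric (𝓡∂ (n + 1)) g p.1) (extChartAt (𝓡 n) p p) := by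
  rw [← chartMetric_inducedMetric g p (extChartAt_mem_bdChart_target p)]
  exact (chartMetric_self (𝓡 n) (inducedMetric g) p).symm

lemma normNablaR_boundary (i : ℕ) (p : Bd n M) {B : Conn (EuclideanSpace ℝ (Fin n)) _}
    (hB : B = tanBd (bdIncl n) (bdChart p).target (chartMetric (𝓡∂ (n + 1)) g p.1)
      (extChartAt (𝓡 n) p p)) :
    normNablaR (𝓡 n) (inducedMetric g) i p =
      normCov (bdChart p).target B (extChartAt (𝓡 n) p p) i (hom B (hom B (hom B B)))
        (curvatureL (bdChart p).target
          (restrictMetric (bdIncl n) (chartMetric (𝓡∂ (n + 1)) g p.1))) := by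
  subst hB
  have hy₀ := extChartAt_mem_bdChart_target p
  have hS := range_eventuallyEq_bdChart_target p
  have hm := chartMetric_inducedMetric g p
  rw [(isHypersurface_boundary g p).restrictMetric.normCov_curvatureL hy₀, normNablaR_eq,
    iterCovDeriv_congr hS hm (curvatureTensor_congr hS hm) i hy₀, hm hy₀]

lemma normNablaL_eq_normCov (i : ℕ) (p : Bd n M) {B : Conn (EuclideanSpace ℝ (Fin n)) _}
    (hB : B = tanBd (bdIncl n) (bdChart p).target (chartMetric (𝓡∂ (n + 1)) g p.1)
      (extChartAt (𝓡 n) p p)) :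
    normNablaL g i p =
      normCov (bdChart p).target B (extChartAt (𝓡 n) p p) i (hom B (hom B (triv _)))
        (secondL (bdIncl n) (extChartAt (𝓡∂ (n + 1)) p.1).target (chartMetric (𝓡∂ (n + 1)) g p.1)
          (fun y => inwardNormal (chartMetric (𝓡∂ (n + 1)) g p.1 (bdIncl n y)))) := by
  subst hB
  have h := isHypersurface_boundary g p
  have hy₀ := extChartAt_mem_bdChart_target p
  have hS := range_eventuallyEq_bdChart_target p
  have hm := chartMetric_inducedMetric g p
  have hsm := h.restrictMetric.smooth_tangent (y₀ := extChartAt (𝓡 n) p p)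
  rw [IsEval.normCov_eq h.restrictMetric hy₀ i (hsm.hom (hsm.hom smooth_triv))
    isEval_triv.cons.cons h.contDiffOn_secondL (fun y hy v => rfl), ← inducedMetric_inner_eq]
  simp only [normNablaL, nablaL]
  rw [iterCovDeriv_congr hS hm (T' := fun y v => evCons (evCons fun _ : Fin 0 → _ =>
    ContinuousLinearMap.id ℝ ℝ) v (secondL (bdIncl n) (extChartAt (𝓡∂ (n + 1)) p.1).target
      (chartMetric (𝓡∂ (n + 1)) g p.1)
      (fun y => inwardNormal (chartMetric (𝓡∂ (n + 1)) g p.1 (bdIncl n y))) y)) ?_ i hy₀]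
  intro y hy
  ext v
  -- `secondForm` differentiates within the range of the model and `secondL` within the chart
  -- target; near the point these sets agree.
  have h1 := fderivWithin_congr_set (f := chartMetric (𝓡∂ (n + 1)) g p.1) (𝕜 := ℝ)
    (range_eventuallyEq_target (𝓡∂ (n + 1)) p.1 (mapsTo_bdIncl p hy))
  simp only [secondForm, christoffel]
  rw [h1]
  rfl

/-- The right-hand side does not depend on `p`. Orders of `l` up to `i + 1` occur because the Ricci
identity differentiates the second fundamental form once. -/
lemma normNablaR_boundary_le (i : ℕ) (p : Bd n M) {K C : ℝ≥0∞}
    (hK : ∀ j < i + 2, normNablaL g j p ≤ K)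
    (hC : ∀ j ≤ i, normNablaR (𝓡∂ (n + 1)) g j p.1 ≤ C) :
    normNablaR (𝓡 n) (inducedMetric g) i p ≤ curvatureBound K C i := by
  rw [normNablaR_boundary g i p rfl]
  refine (isHypersurface_boundary g p).normCov_curvatureL_le (extChartAt_mem_bdChart_target p) i
    (fun j hj => ?_) (fun j hj => ?_)
  · rw [← normNablaL_eq_normCov g j p rfl]
    exact hK j hj
  · rw [← normNablaR_eq_normCov (𝓡∂ (n + 1)) g j p.1 (bdIncl_extChartAt p) rfl]
    exact hC j hj

end BoundaryChart

/-! ### The injectivity radius -/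

section Injectivity

variable {E : Type*} [NormedAddCommGroup E] [NormedSpace ℝ E]
  {H : Type*} [TopologicalSpace H] (I : ModelWithCorners ℝ E H)
  {M : Type*} [TopologicalSpace M] [ChartedSpace H M] [IsManifold I ∞ M]
  (g : Bundle.ContMDiffRiemannianMetric I ∞ E (fun x : M => TangentSpace I x))

lemma ExpDiffeoOnBall.mono {x : M} {r r' : ℝ} (hr : r ≤ r') (h : ExpDiffeoOnBall I g x r') :
    ExpDiffeoOnBall I g x r := by
  obtain ⟨f, hexp, hf, hinv⟩ := h
  have hsub : tangentBall I g x r ⊆ tangentBall I g x r' := fun v hv =>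
    ⟨hv.1.trans_le hr, hv.2.trans_le (pow_le_pow_left₀ hv.1.le hr 2)⟩
  refine ⟨f, fun v hv => hexp v (hsub hv), hf.mono hsub, fun hne => ?_⟩
  obtain ⟨k, hk, hk'⟩ := hinv (hne.mono hsub)
  exact ⟨k, hk.mono hsub, hk'.mono (image_mono hsub)⟩

/-- A radius strictly between zero and the infimum is exceeded at every point by an admissible
radius, and admissibility passes to smaller balls. -/
lemma exists_expDiffeoOnBall (h : 0 < injectivityRadius I g) :
    ∃ ri > 0, ∀ r, 0 < r → r ≤ ri → ∀ x, ExpDiffeoOnBall I g x r := by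
  obtain ⟨ri, h0, hri⟩ := ENNReal.lt_iff_exists_nnreal_btwn.1 h
  refine ⟨ri, by exact_mod_cast h0, fun r _ hr x => ?_⟩
  have h1 := hri.trans_le (iInf_le _ x)
  obtain ⟨r', hr'⟩ := lt_iSup_iff.1 h1
  obtain ⟨hexp, hlt⟩ := lt_iSup_iff.1 hr'
  exact hexp.mono I g (hr.trans (by exact_mod_cast hlt.le))

end Injectivity

end BddGeom
end

theorem corollary2p12 {n : ℕ} {M : Type*} [TopologicalSpace M] [T2Space M]
    [ChartedSpace (EuclideanHalfSpace (n + 1)) M] [IsManifold (𝓡∂ (n + 1)) ∞ M]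
    (g : Bundle.ContMDiffRiemannianMetric (𝓡∂ (n + 1)) ∞ (EuclideanSpace ℝ (Fin (n + 1)))
      (fun x : M => TangentSpace (𝓡∂ (n + 1)) x))
    (hM : BddGeom.BoundedGeometry g) :
    BddGeom.BoundedGeometryWithoutBoundary (BddGeom.inducedMetric g) := by
  refine ⟨BddGeom.exists_expDiffeoOnBall _ _ hM.inj_boundary, fun k => ?_⟩
  -- Order `k` of the induced curvature uses `l` up to order `k + 1` and `R` up to order `k`, so `k
  -- + 2` suffices.
  obtain ⟨C, -, hC⟩ := hM.curv (k + 2)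
  set K := ENNReal.ofReal C
  set D := ∑ i ∈ Finset.range (k + 1), BddGeom.curvatureBound K K i
  have hD : D ≠ ⊤ := ENNReal.sum_ne_top.2 fun i _ =>
    BddGeom.curvatureBound_ne_top ENNReal.ofReal_ne_top ENNReal.ofReal_ne_top i
  -- The sum `D` dominates the bounds of all orders `i ≤ k`; adding one makes the constant strictly
  -- positive.
  refine ⟨D.toReal + 1, by positivity, fun i hi p => ?_⟩
  calc _ ≤ BddGeom.curvatureBound K K i := BddGeom.normNablaR_boundary_le g i p
        (fun j hj => (hC j (by omega)).2 p) (fun j hj => (hC j (by omega)).1 p.1)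
    _ ≤ D := Finset.single_le_sum (f := fun i => BddGeom.curvatureBound K K i)
        (fun _ _ => zero_le) (Finset.mem_range.2 (by omega))
    _ = ENNReal.ofReal D.toReal := (ENNReal.ofReal_toReal hD).symm
    _ ≤ _ := ENNReal.ofReal_le_ofReal (by linarith)
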